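/- Let $\Omega\subset\mathbb{R}^3$ be an open bounded set and let $\mathcal{T}_h$ be a matching tetrahedral mesh of $\Omega$, i.e. a finite collection of pairwise disjoint, nondegenerate open tetrahedra with $\overline{\Omega}=\bigcup_{T\in\mathcal{T}_h}\overline{T}$, such that any two closed tetrahedra $\overline{T},\overline{T'}$ meet exactly in the (possibly empty) simplex spanned by their common vertices. Let $\mathcal{F}_h$ be the set of all triangular faces of mesh elements, $\mathcal{F}_T$ the set of the four faces of $T$, $\mathcal{F}_h^{\rm b}$ the set of the faces $F\subset\partial\Omega$, and $\boldsymbol{n}_{TF}$ the unit normal to $F\in\mathcal{F}_T$ pointing out of $T$. For an element or a face $X$ let $\mathcal{P}^q(X)$ be the space of polynomial functions on $X$ of total degree at most $q$ (in three, respectively two, variables), let $\boldsymbol{\mathcal{P}}^q(T)=\mathcal{P}^q(T)^3$, and let $(\cdot,\cdot)_X$ and $\|\cdot\|_X$ denote the $L^2(X)$ inner product and norm (with respect to Lebesgue measure on elements and on $\Omega$, and surface measure on faces). Let $k\ge 0$ be an integer, and let $$\underline{\rm Y}_{h,0}^{k+1}=\Big\{\underline{q}_h=\big((q_T)_{T\in\mathcal{T}_h},(q_F)_{F\in\mathcal{F}_h}\big)\;:\;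 q_T\in\mathcal{P}^k(T)\ \forall T\in\mathcal{T}_h,\quad q_F\in\mathcal{P}^{k+1}(F)\ \forall F\in\mathcal{F}_h,\quad q_F=0\ \forall F\in\mathcal{F}_h^{\rm b}\Big\}.$$ For $\underline{q}_h$ in this space and $T\in\mathcal{T}_h$, let $\boldsymbol{G}_T^{k+1}\underline{q}_T\in\boldsymbol{\mathcal{P}}^{k+1}(T)$ be the unique solution of $$\big(\boldsymbol{G}_T^{k+1}\underline{q}_T,\boldsymbol{w}\big)_T=-(q_T,\operatorname{div}\boldsymbol{w})_T+\sum_{F\in\mathcal{F}_T}\big(q_F,\boldsymbol{w}_{|F}\cdot\boldsymbol{n}_{TF}\big)_F\qquad\forall\,\boldsymbol{w}\in\boldsymbol{\mathcal{P}}^{k+1}(T),$$ and let $\boldsymbol{G}_h^{k+1}\underline{q}_h$ be the piecewise polynomial vector field on $\Omega$ whose restriction to each $T\in\mathcal{T}_h$ is $\boldsymbol{G}_T^{k+1}\underline{q}_T$. Then the map $\underline{q}_h\mapsto\|\boldsymbol{G}_h^{k+1}\underline{q}_h\|_{\Omega}$ is a norm on $\underline{\rm Y}_{h,0}^{k+1}$.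 -/

import Mathlib

open MeasureTheory
open scoped RealInnerProductSpace

/-- Three-dimensional Euclidean space. -/
abbrev E3 : Type := EuclideanSpace ℝ (Fin 3)

/-! ### Polynomial functions -/

/-- The value of a polynomial in three variables at a point of space. -/
noncomputable def evalPt (p : MvPolynomial (Fin 3) ℝ) (x : E3) : ℝ :=
  MvPolynomial.eval (fun i => x i) p

/-- The value of a vector field with polynomial components at a point of space. -/
noncomputable def evalVec (w : Fin 3 → MvPolynomial (Fin 3) ℝ) (x : E3) : E3 :=
  WithLp.toLp 2 fun i => evalPt (w i) x

/-- The divergence of a polynomial vector field. -/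
noncomputable def polyDiv (w : Fin 3 → MvPolynomial (Fin 3) ℝ) : MvPolynomial (Fin 3) ℝ :=
  ∑ i, MvPolynomial.pderiv i (w i)

/-- The space `𝒫^q(X)` of scalar polynomial functions of total degree at most `q` on `X`.
If `X` is a planar face, the restrictions to `X` of polynomials of degree at most `q` in three
variables are exactly the polynomial functions of degree at most `q` in two affine coordinates
of the plane of `X`. -/
noncomputable def polyOn (q : ℕ) (X : Set E3) : Submodule ℝ (X → ℝ) where
  carrier := {f | ∃ p : MvPolynomial (Fin 3) ℝ, p.totalDegree ≤ q ∧ ∀ x : X, f x = evalPt p x}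
  add_mem' := by
    rintro f g ⟨p, hp, hf⟩ ⟨r, hr, hg⟩
    exact ⟨p + r, (MvPolynomial.totalDegree_add p r).trans (max_le hp hr), fun x => by
      simp [evalPt, hf, hg]⟩
  zero_mem' := ⟨0, by simp, fun x => by simp [evalPt]⟩
  smul_mem' := by
    rintro c f ⟨p, hp, hf⟩
    exact ⟨c • p, (MvPolynomial.totalDegree_smul_le c p).trans hp, fun x => by
      simp [evalPt, hf, MvPolynomial.smul_eval]⟩

/-- Polynomial functions with values in `ℝ³`, of total degree at most `q`, on `X`. -/
noncomputable def vecPolyOn (q : ℕ) (X : Set E3) : Submodule ℝ (X → E3) where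
  carrier := {f | ∃ w : Fin 3 → MvPolynomial (Fin 3) ℝ,
    (∀ i, (w i).totalDegree ≤ q) ∧ ∀ x : X, f x = evalVec w x}
  add_mem' := by
    rintro f g ⟨p, hp, hf⟩ ⟨r, hr, hg⟩
    refine ⟨p + r, fun i =>
      (MvPolynomial.totalDegree_add (p i) (r i)).trans (max_le (hp i) (hr i)), fun x => ?_⟩
    ext i
    simp [evalVec, evalPt, hf, hg]
  zero_mem' := ⟨0, by simp, fun x => by ext i; simp [evalVec, evalPt]⟩
  smul_mem' := by
    rintro c f ⟨p, hp, hf⟩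
    refine ⟨c • p, fun i => (MvPolynomial.totalDegree_smul_le c (p i)).trans (hp i), fun x => ?_⟩
    ext i
    simp [evalVec, evalPt, hf, MvPolynomial.smul_eval]

/-! ### Tetrahedra and their faces, given by their vertices -/

/-- `T` is the vertex set of a nondegenerate tetrahedron. -/
def IsTetrahedron (T : Finset E3) : Prop :=
  T.card = 4 ∧ AffineIndependent ℝ ((↑) : T → E3)

/-- The closed simplex with the given vertices. -/
def closedCell (S : Finset E3) : Set E3 := convexHull ℝ (S : Set E3)

/-- The open tetrahedron with vertex set `T`. -/
def openCell (T : Finset E3) : Set E3 := interior (closedCell T)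

/-- The faces of the tetrahedron with vertex set `T`: the triangles spanned by
three of its vertices. -/
abbrev FacesOf (T : Finset E3) : Type := {F : Finset E3 // F ∈ T.powersetCard 3}

/-- The unit normal to the face `F` of the tetrahedron `T` pointing out of `T`: the normalized
component, orthogonal to the plane of `F`, of the vector from the barycentre of `T` to the
barycentre of `F`. -/
noncomputable def outwardNormal (T F : Finset E3) : E3 :=
  let v : E3 := (vectorSpan ℝ (F : Set E3))ᗮ.starProjection
    (F.centroid ℝ id - T.centroid ℝ id)
  ‖v‖⁻¹ • v

/-- The outward normal is a unit vector, orthogonal to the face, and points away from the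
opposite vertex. -/
theorem outwardNormal_spec {T F : Finset E3} (hT : IsTetrahedron T) (hF : F ∈ T.powersetCard 3) :
    ‖outwardNormal T F‖ = 1 ∧ outwardNormal T F ∈ (vectorSpan ℝ (F : Set E3))ᗮ ∧
      ∀ a ∈ T, a ∉ F → ∀ x ∈ F, 0 < ⟪outwardNormal T F, x - a⟫ := by
  classical
  obtain ⟨hFT, hF3⟩ := Finset.mem_powersetCard.mp hF
  set V := vectorSpan ℝ (F : Set E3) with hV
  obtain ⟨a, ha⟩ : ∃ a, T \ F = {a} := by
    rw [← Finset.card_eq_one, Finset.card_sdiff_of_subset hFT, hF3, hT.1]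
  have haT : a ∈ T := (Finset.mem_sdiff.mp (ha ▸ Finset.mem_singleton_self a)).1
  have haF : a ∉ F := (Finset.mem_sdiff.mp (ha ▸ Finset.mem_singleton_self a)).2
  have hTF : T = insert a F := by
    rw [← Finset.sdiff_union_of_subset hFT, ha]; rfl
  have hne : F.Nonempty := Finset.card_pos.mp (by omega)
  have hcT : T.centroid ℝ id = (4 : ℝ)⁻¹ • (a + ∑ y ∈ F, y) := by
    rw [Finset.centroid_eq_centerMass _ ⟨a, haT⟩, Finset.centerMass, hTF]
    simp [Finset.sum_insert haF, Finset.card_insert_of_notMem haF, hF3, Finset.smul_sum]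
    norm_num
  have hcF : F.centroid ℝ id = (3 : ℝ)⁻¹ • ∑ y ∈ F, y := by
    rw [Finset.centroid_eq_centerMass _ hne, Finset.centerMass]
    simp [hF3, Finset.smul_sum]
  have hdiff : ∀ x ∈ F, ∃ y ∈ V,
      F.centroid ℝ id - T.centroid ℝ id = (4 : ℝ)⁻¹ • (x - a) + y := by
    intro x hx
    refine ⟨(12 : ℝ)⁻¹ • ∑ y ∈ F, (y - x), V.smul_mem _ (V.sum_mem fun y hy =>
      vsub_mem_vectorSpan ℝ hy hx), ?_⟩
    rw [hcT, hcF, Finset.sum_sub_distrib, Finset.sum_const, hF3]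
    module
  have hxa : ∀ x ∈ F, x - a ∉ V := by
    intro x hx hmem
    have h1 : a ∈ affineSpan ℝ (F : Set E3) := by
      have h2 : (a - x) +ᵥ x ∈ affineSpan ℝ (F : Set E3) :=
        AffineSubspace.vadd_mem_of_mem_direction
          (by rw [direction_affineSpan]; simpa using V.neg_mem hmem) (subset_affineSpan ℝ _ hx)
      simpa using h2
    have h3 := hT.2.notMem_affineSpan_sdiff ⟨a, haT⟩ Set.univ
    apply h3
    refine affineSpan_mono ℝ ?_ h1
    intro y hy
    refine ⟨⟨y, hFT hy⟩, ⟨trivial, ?_⟩, rfl⟩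
    intro h
    apply haF
    have : y = a := congrArg Subtype.val h
    exact this ▸ hy
  have hproj : ∀ x ∈ F, Vᗮ.starProjection (F.centroid ℝ id - T.centroid ℝ id)
      = (4 : ℝ)⁻¹ • Vᗮ.starProjection (x - a) := by
    intro x hx
    obtain ⟨y, hy, h⟩ := hdiff x hx
    have hy0 : Vᗮ.starProjection y = 0 :=
      (Submodule.starProjection_apply_eq_zero_iff _).2 (by simpa using hy)
    rw [h, map_add, map_smul, hy0, add_zero]
  have hne0 : ∀ x ∈ F, Vᗮ.starProjection (x - a) ≠ 0 := by
    intro x hx h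
    apply hxa x hx
    simpa using (Submodule.starProjection_apply_eq_zero_iff _).1 h
  obtain ⟨x0, hx0⟩ := hne
  have hv : Vᗮ.starProjection (F.centroid ℝ id - T.centroid ℝ id) ≠ 0 := by
    rw [hproj x0 hx0]
    exact smul_ne_zero (by norm_num) (hne0 x0 hx0)
  refine ⟨norm_smul_inv_norm hv, Vᗮ.smul_mem _ (Submodule.starProjection_apply_mem _ _), ?_⟩
  intro b hbT hbF x hx
  obtain rfl : b = a := by
    have : b ∈ T \ F := Finset.mem_sdiff.mpr ⟨hbT, hbF⟩
    simpa [ha] using this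
  have hpos : 0 < ⟪Vᗮ.starProjection (x - b), x - b⟫ := by
    have h1 := Submodule.isIdempotentElem_starProjection Vᗮ
    have h2 : Vᗮ.starProjection (Vᗮ.starProjection (x - b)) = Vᗮ.starProjection (x - b) :=
      congrArg (fun f : E3 →L[ℝ] E3 => f (x - b)) h1
    rw [← h2, Submodule.inner_starProjection_left_eq_right, real_inner_self_eq_norm_sq]
    exact pow_pos (norm_pos_iff.2 (hne0 x hx)) 2
  simp only [outwardNormal]
  simp only [← hV]
  rw [hproj x hx, smul_smul, real_inner_smul_left]
  refine mul_pos (mul_pos (inv_pos.2 (norm_pos_iff.2 (smul_ne_zero (by norm_num) (hne0 x hx)))) (by norm_num)) hpos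

/-- Integral over the open tetrahedron `T` with respect to Lebesgue measure. -/
noncomputable def intCell (T : Finset E3) (f : openCell T → ℝ) : ℝ :=
  ∫ x, f x ∂((volume : Measure E3).comap (Subtype.val : openCell T → E3))

/-- Integral over the triangle `F` with respect to the surface measure (the two-dimensional
Hausdorff measure, normalized to agree with Lebesgue measure in planes). -/
noncomputable def intFace (F : Finset E3) (f : closedCell F → ℝ) : ℝ :=
  ∫ x, f x ∂((μHE[2] : Measure E3).comap (Subtype.val : closedCell F → E3))

/-! ### The local gradient reconstruction -/

/-- `g` solves the problem defining the local gradient reconstruction of `(qT, (qF)_F)`: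
`(g, w)_T = -(qT, div w)_T + ∑_F (qF, w|_F · n_TF)_F` for all `w ∈ 𝒫^{k+1}(T)³`. -/
def IsLocalGrad (k : ℕ) (T : Finset E3) (qT : polyOn k (openCell T))
    (qF : (F : FacesOf T) → polyOn (k + 1) (closedCell F.1))
    (g : vecPolyOn (k + 1) (openCell T)) : Prop :=
  ∀ w : Fin 3 → MvPolynomial (Fin 3) ℝ, (∀ i, (w i).totalDegree ≤ k + 1) →
    intCell T (fun x => ⟪g.1 x, evalVec w x⟫) =
      - intCell T (fun x => qT.1 x * evalPt (polyDiv w) x)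
      + ∑ F : FacesOf T,
          intFace F.1 (fun x => (qF F).1 x * ⟪evalVec w x, outwardNormal T F.1⟫)

/-! ### Well-posedness of the local problem -/

theorem continuous_evalPt (p : MvPolynomial (Fin 3) ℝ) : Continuous (evalPt p) := by
  unfold evalPt
  have h : Continuous (fun y : Fin 3 → ℝ => MvPolynomial.eval y p) := p.continuous_eval
  exact h.comp (by fun_prop)

theorem continuous_evalVec (w : Fin 3 → MvPolynomial (Fin 3) ℝ) : Continuous (evalVec w) := by
  unfold evalVec
  exact (PiLp.continuous_toLp 2 _).comp (continuous_pi fun i => continuous_evalPt (w i))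

theorem isCompact_closedCell (S : Finset E3) : IsCompact (closedCell S) :=
  S.finite_toSet.isCompact_convexHull ℝ

theorem surface_closedCell_lt_top {F : Finset E3} (hF : F.card = 3) :
    (μHE[2] : Measure E3) (closedCell F) < ⊤ := by
  classical
  obtain ⟨a, b, c, -, -, -, rfl⟩ := Finset.card_eq_three.mp hF
  let l : EuclideanSpace ℝ (Fin 2) →L[ℝ] E3 :=
    (EuclideanSpace.proj (0 : Fin 2) : EuclideanSpace ℝ (Fin 2) →L[ℝ] ℝ).smulRight (b - a)
    + (EuclideanSpace.proj (1 : Fin 2) : EuclideanSpace ℝ (Fin 2) →L[ℝ] ℝ).smulRight (c - a)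
  let A : EuclideanSpace ℝ (Fin 2) →ᵃ[ℝ] E3 :=
    l.toLinearMap.toAffineMap + AffineMap.const ℝ _ a
  have hA : LipschitzWith ‖l‖₊ A := by
    refine LipschitzWith.of_dist_le_mul fun x y => ?_
    have h : A x - A y = l (x - y) := by simp [A]
    rw [dist_eq_norm, dist_eq_norm, h]
    exact l.le_opNorm _
  let S : Set (EuclideanSpace ℝ (Fin 2)) := {!₂[0, 0], !₂[1, 0], !₂[0, 1]}
  have hS : closedCell {a, b, c} = A '' convexHull ℝ S := by
    rw [A.image_convexHull]
    simp [closedCell, S, A, l, Set.image_insert_eq]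
  have hfin : (μH[(2 : ℕ)] : Measure (EuclideanSpace ℝ (Fin 2))) (convexHull ℝ S) < ⊤ :=
    ((show S.Finite by simp [S]).isCompact_convexHull ℝ).measure_lt_top
  have hle := hA.hausdorffMeasure_image_le (d := ((2 : ℕ) : ℝ)) (by simp) (convexHull ℝ S)
  rw [Measure.euclideanHausdorffMeasure_def, hS, Measure.smul_apply, ENNReal.smul_def, smul_eq_mul]
  refine ENNReal.mul_lt_top ENNReal.coe_lt_top (hle.trans_lt ?_)
  exact ENNReal.mul_lt_top (ENNReal.rpow_lt_top_of_nonneg (by simp) (by simp)) hfin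

theorem integrable_comap_of_continuous {μ : Measure E3} {X K : Set E3} (hX : MeasurableSet X)
    (hXK : X ⊆ K) (hK : IsCompact K) (hμ : μ K < ⊤) {f : E3 → ℝ} (hf : Continuous f) :
    Integrable (fun x : X => f x) (μ.comap (Subtype.val : X → E3)) := by
  have h : IntegrableOn f X μ := by
    obtain ⟨C, hC⟩ := hK.exists_bound_of_continuousOn hf.continuousOn
    exact Measure.integrableOn_of_bounded ((measure_mono hXK).trans_lt hμ).ne
      hf.aestronglyMeasurable (M := C)
      ((ae_restrict_mem hX).mono fun x hx => hC x (hXK hx))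
  rw [IntegrableOn, ← map_comap_subtype_coe hX,
    (MeasurableEmbedding.subtype_coe hX).integrable_map_iff] at h
  exact h

theorem integrable_cell (T : Finset E3) {f : E3 → ℝ} (hf : Continuous f) :
    Integrable (fun x : openCell T => f x)
      ((volume : Measure E3).comap (Subtype.val : openCell T → E3)) :=
  integrable_comap_of_continuous isOpen_interior.measurableSet interior_subset
    (isCompact_closedCell T) (isCompact_closedCell T).measure_lt_top hf

theorem integrable_face {F : Finset E3} (hF : F.card = 3) {f : E3 → ℝ} (hf : Continuous f) :
    Integrable (fun x : closedCell F => f x)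
      ((μHE[2] : Measure E3).comap (Subtype.val : closedCell F → E3)) :=
  integrable_comap_of_continuous (isCompact_closedCell F).measurableSet subset_rfl
    (isCompact_closedCell F) (surface_closedCell_lt_top hF) hf

theorem IsTetrahedron.openCell_nonempty {T : Finset E3} (hT : IsTetrahedron T) :
    (openCell T).Nonempty := by
  rw [openCell, closedCell, interior_convexHull_nonempty_iff_affineSpan_eq_top]
  have h := hT.2.affineSpan_eq_top_iff_card_eq_finrank_add_one
  simp only [Subtype.range_coe_subtype, Finset.setOfPred_mem, Fintype.card_coe, hT.1] at h
  exact h.2 (by simp)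

/-- A polynomial field that vanishes on a nonempty open set is zero. -/
theorem evalVec_eq_zero_of_isOpen {U : Set E3} (hU : IsOpen U) (hne : U.Nonempty)
    {w : Fin 3 → MvPolynomial (Fin 3) ℝ} (hw : ∀ x ∈ U, evalVec w x = 0) : w = 0 := by
  obtain ⟨x, hx⟩ := hne
  have hV : IsOpen ((WithLp.toLp 2 : (Fin 3 → ℝ) → E3) ⁻¹' U) :=
    hU.preimage (PiLp.continuous_toLp 2 _)
  obtain ⟨r, hr, hball⟩ := Metric.isOpen_iff.mp hV x.ofLp (by simpa using hx)
  funext i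
  refine MvPolynomial.funext_set (fun j => Metric.ball (x j) r) (fun j => ?_) fun y hy => ?_
  · rw [Real.ball_eq_Ioo]
    exact Set.Ioo_infinite (by linarith)
  · have hyU : WithLp.toLp 2 y ∈ U := by
      refine hball ?_
      rw [← ball_pi _ hr] at hy
      exact hy
    have h := congrArg (fun z : E3 => z i) (hw _ hyU)
    simpa [evalVec, evalPt] using h

theorem exists_continuous_of_mem_polyOn {q : ℕ} {X : Set E3} (f : polyOn q X) :
    ∃ P : E3 → ℝ, Continuous P ∧ ∀ x : X, f.1 x = P x := by
  obtain ⟨p, -, hp⟩ := f.2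
  exact ⟨evalPt p, continuous_evalPt p, hp⟩

theorem evalPt_add (p r : MvPolynomial (Fin 3) ℝ) (x : E3) :
    evalPt (p + r) x = evalPt p x + evalPt r x := by simp [evalPt]

theorem evalPt_smul (c : ℝ) (p : MvPolynomial (Fin 3) ℝ) (x : E3) :
    evalPt (c • p) x = c * evalPt p x := by simp [evalPt, MvPolynomial.smul_eval]

theorem evalVec_add (p r : Fin 3 → MvPolynomial (Fin 3) ℝ) (x : E3) :
    evalVec (p + r) x = evalVec p x + evalVec r x := by ext i; simp [evalVec, evalPt]

theorem evalVec_smul (c : ℝ) (p : Fin 3 → MvPolynomial (Fin 3) ℝ) (x : E3) :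
    evalVec (c • p) x = c • evalVec p x := by
  ext i; simp [evalVec, evalPt, MvPolynomial.smul_eval]

theorem polyDiv_add (p r : Fin 3 → MvPolynomial (Fin 3) ℝ) :
    polyDiv (p + r) = polyDiv p + polyDiv r := by
  simp [polyDiv, Finset.sum_add_distrib]

theorem polyDiv_smul (c : ℝ) (p : Fin 3 → MvPolynomial (Fin 3) ℝ) :
    polyDiv (c • p) = c • polyDiv p := by
  simp [polyDiv, Finset.smul_sum]

/-- Triples of polynomials of total degree at most `q`. -/
abbrev PolyTriple (q : ℕ) : Type := Fin 3 → MvPolynomial.restrictTotalDegree (Fin 3) ℝ q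

/-- The underlying triple of polynomials. -/
noncomputable def PolyTriple.poly {q : ℕ} : PolyTriple q →ₗ[ℝ] Fin 3 → MvPolynomial (Fin 3) ℝ :=
  LinearMap.pi fun i => (Submodule.subtype _).comp (LinearMap.proj i)

/-- The `L²(T)` inner product on polynomial fields. -/
noncomputable def cellForm (q : ℕ) (T : Finset E3) : LinearMap.BilinForm ℝ (PolyTriple q) :=
  LinearMap.mk₂ ℝ (fun u w => intCell T fun x => ⟪evalVec u.poly x, evalVec w.poly x⟫)
    (fun u u' w => by
      have h := fun v : PolyTriple q => integrable_cell T
        ((continuous_evalVec v.poly).inner (𝕜 := ℝ) (continuous_evalVec w.poly))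
      simp only [intCell, map_add, evalVec_add, inner_add_left]
      exact integral_add (h u) (h u'))
    (fun c u w => by
      simp only [intCell, map_smul, evalVec_smul, real_inner_smul_left, smul_eq_mul]
      exact integral_const_mul _ _)
    (fun w u u' => by
      have h := fun v : PolyTriple q => integrable_cell T
        ((continuous_evalVec w.poly).inner (𝕜 := ℝ) (continuous_evalVec v.poly))
      simp only [intCell, map_add, evalVec_add, inner_add_right]
      exact integral_add (h u) (h u'))
    (fun c u w => by
      simp only [intCell, map_smul, evalVec_smul, real_inner_smul_right, smul_eq_mul]
      exact integral_const_mul _ _)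

theorem cellForm_apply (q : ℕ) (T : Finset E3) (u w : PolyTriple q) :
    cellForm q T u w = intCell T fun x => ⟪evalVec u.poly x, evalVec w.poly x⟫ := rfl

theorem eq_zero_of_cellForm_self {q : ℕ} {T : Finset E3} (hT : IsTetrahedron T)
    {u : PolyTriple q} (hu : cellForm q T u u = 0) : u = 0 := by
  have hc : Continuous fun x : E3 => ⟪evalVec u.poly x, evalVec u.poly x⟫ :=
    (continuous_evalVec _).inner (continuous_evalVec _)
  have hm : MeasurableSet (openCell T) := isOpen_interior.measurableSet
  have h1 : (fun x => ⟪evalVec u.poly x, evalVec u.poly x⟫) =ᵐ[volume.restrict (openCell T)]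
      (0 : E3 → ℝ) := by
    rw [← setIntegral_eq_zero_iff_of_nonneg_ae (ae_of_all _ fun x => real_inner_self_nonneg)]
    · rw [cellForm_apply, intCell] at hu
      rw [← hu, ← map_comap_subtype_coe hm, (MeasurableEmbedding.subtype_coe hm).integral_map]
    · rw [IntegrableOn, ← map_comap_subtype_coe hm,
        (MeasurableEmbedding.subtype_coe hm).integrable_map_iff]
      exact integrable_cell T hc
  have h2 := Measure.eqOn_open_of_ae_eq h1 isOpen_interior hc.continuousOn
    continuousOn_const
  have h3 : u.poly = 0 := evalVec_eq_zero_of_isOpen isOpen_interior hT.openCell_nonempty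
    fun x hx => by simpa using h2 hx
  funext i
  ext1
  exact congrFun h3 i

theorem cellForm_nondegenerate {q : ℕ} {T : Finset E3} (hT : IsTetrahedron T) :
    (cellForm q T).Nondegenerate :=
  ⟨fun u hu => eq_zero_of_cellForm_self hT (hu u), fun u hu => eq_zero_of_cellForm_self hT (hu u)⟩

/-- The right-hand side of the local problem, as a linear form. -/
noncomputable def localRhs (k : ℕ) (T : Finset E3) (qT : polyOn k (openCell T))
    (qF : (F : FacesOf T) → polyOn (k + 1) (closedCell F.1)) :
    Module.Dual ℝ (PolyTriple (k + 1)) where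
  toFun w := - intCell T (fun x => qT.1 x * evalPt (polyDiv w.poly) x)
      + ∑ F : FacesOf T,
          intFace F.1 (fun x => (qF F).1 x * ⟪evalVec w.poly x, outwardNormal T F.1⟫)
  map_add' u w := by
    have h1 : intCell T (fun x => qT.1 x * evalPt (polyDiv (u + w : PolyTriple _).poly) x)
        = intCell T (fun x => qT.1 x * evalPt (polyDiv u.poly) x)
          + intCell T (fun x => qT.1 x * evalPt (polyDiv w.poly) x) := by
      obtain ⟨P, hP, hq⟩ := exists_continuous_of_mem_polyOn qT
      simp only [intCell, map_add, polyDiv_add, evalPt_add, mul_add, hq]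
      exact integral_add (integrable_cell T (hP.mul (continuous_evalPt _)))
        (integrable_cell T (hP.mul (continuous_evalPt _)))
    have h2 : ∀ F : FacesOf T,
        intFace F.1 (fun x => (qF F).1 x *
          ⟪evalVec (u + w : PolyTriple _).poly x, outwardNormal T F.1⟫)
        = intFace F.1 (fun x => (qF F).1 x * ⟪evalVec u.poly x, outwardNormal T F.1⟫)
          + intFace F.1 (fun x => (qF F).1 x * ⟪evalVec w.poly x, outwardNormal T F.1⟫) := by
      intro F
      obtain ⟨P, hP, hq⟩ := exists_continuous_of_mem_polyOn (qF F)
      have hF : F.1.card = 3 := (Finset.mem_powersetCard.mp F.2).2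
      simp only [intFace, map_add, evalVec_add, inner_add_left, mul_add, hq]
      exact integral_add
        (integrable_face hF (hP.mul ((continuous_evalVec _).inner continuous_const)))
        (integrable_face hF (hP.mul ((continuous_evalVec _).inner continuous_const)))
    simp only [h1, h2, Finset.sum_add_distrib]
    ring
  map_smul' c w := by
    have h1 : intCell T (fun x => qT.1 x * evalPt (polyDiv (c • w : PolyTriple _).poly) x)
        = c * intCell T (fun x => qT.1 x * evalPt (polyDiv w.poly) x) := by
      simp only [intCell, map_smul, polyDiv_smul, evalPt_smul, mul_left_comm _ c]
      exact integral_const_mul _ _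
    have h2 : ∀ F : FacesOf T,
        intFace F.1 (fun x => (qF F).1 x *
          ⟪evalVec (c • w : PolyTriple _).poly x, outwardNormal T F.1⟫)
        = c * intFace F.1 (fun x => (qF F).1 x * ⟪evalVec w.poly x, outwardNormal T F.1⟫) := by
      intro F
      simp only [intFace, map_smul, evalVec_smul, real_inner_smul_left, mul_left_comm _ c]
      exact integral_const_mul _ _
    simp only [h1, h2, ← Finset.mul_sum, RingHom.id_apply, smul_eq_mul]
    ring

/-- The local problem has exactly one solution. -/
theorem existsUnique_isLocalGrad (k : ℕ) {T : Finset E3} (hT : IsTetrahedron T)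
    (qT : polyOn k (openCell T)) (qF : (F : FacesOf T) → polyOn (k + 1) (closedCell F.1)) :
    ∃! g : vecPolyOn (k + 1) (openCell T), IsLocalGrad k T qT qF g := by
  let u := ((cellForm (k + 1) T).toDual (cellForm_nondegenerate hT)).symm (localRhs k T qT qF)
  have hu : ∀ w, cellForm (k + 1) T u w = localRhs k T qT qF w :=
    fun w => LinearMap.BilinForm.apply_toDual_symm_apply (hB := cellForm_nondegenerate hT) _ w
  refine ⟨⟨fun x => evalVec u.poly x, u.poly,
    fun i => (MvPolynomial.mem_restrictTotalDegree _ _ _).1 (u i).2, fun x => rfl⟩, ?_, ?_⟩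
  · intro w hw
    exact hu fun i => ⟨w i, (MvPolynomial.mem_restrictTotalDegree _ _ _).2 (hw i)⟩
  · rintro ⟨g, v, hv, hg⟩ hsol
    let v' : PolyTriple (k + 1) :=
      fun i => ⟨v i, (MvPolynomial.mem_restrictTotalDegree _ _ _).2 (hv i)⟩
    have hv' : ∀ w, cellForm (k + 1) T v' w = localRhs k T qT qF w := by
      intro w
      have h := hsol w.poly fun i => (MvPolynomial.mem_restrictTotalDegree _ _ _).1 (w i).2
      simp only [hg] at h
      exact h
    have h0 : v' - u = 0 := by
      apply eq_zero_of_cellForm_self hT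
      rw [LinearMap.BilinForm.sub_left, hu, hv', sub_self]
    have h1 : v = u.poly := by
      rw [← sub_eq_zero.mp h0]
      rfl
    apply Subtype.ext
    funext x
    simp only [hg, h1]

/-- The local gradient reconstruction `G_T^{k+1} (qT, (qF)_F) ∈ 𝒫^{k+1}(T)³`. -/
noncomputable def localGrad (k : ℕ) {T : Finset E3} (hT : IsTetrahedron T)
    (qT : polyOn k (openCell T)) (qF : (F : FacesOf T) → polyOn (k + 1) (closedCell F.1)) :
    vecPolyOn (k + 1) (openCell T) :=
  (existsUnique_isLocalGrad k hT qT qF).choose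

theorem localGrad_spec (k : ℕ) {T : Finset E3} (hT : IsTetrahedron T)
    (qT : polyOn k (openCell T)) (qF : (F : FacesOf T) → polyOn (k + 1) (closedCell F.1)) :
    IsLocalGrad k T qT qF (localGrad k hT qT qF) :=
  (existsUnique_isLocalGrad k hT qT qF).choose_spec.1

/-! ### Matching tetrahedral meshes, hybrid spaces, and the global reconstruction -/

/-- A matching tetrahedral mesh of `Ω`: a finite collection of disjoint open tetrahedra whose
closures cover the closure of `Ω`, such that any two closed tetrahedra meet exactly in the
(possibly empty) simplex spanned by their common vertices. -/
structure MatchingTetMesh (Ω : Set E3) where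
  /-- The vertex sets of the mesh elements. -/
  elems : Finset (Finset E3)
  isTetrahedron : ∀ T ∈ elems, IsTetrahedron T
  disjoint : ∀ T ∈ elems, ∀ T' ∈ elems, T ≠ T' → Disjoint (openCell T) (openCell T')
  cover : closure Ω = ⋃ T ∈ elems, closedCell T
  matching : ∀ T ∈ elems, ∀ T' ∈ elems,
    closedCell T ∩ closedCell T' = convexHull ℝ ((T : Set E3) ∩ (T' : Set E3))

namespace MatchingTetMesh

variable {Ω : Set E3}

/-- The mesh elements. -/
abbrev Elem (M : MatchingTetMesh Ω) : Type := {T : Finset E3 // T ∈ M.elems}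

/-- The mesh faces, i.e. the faces of the mesh elements. -/
abbrev Face (M : MatchingTetMesh Ω) : Type :=
  {F : Finset E3 // ∃ T ∈ M.elems, F ∈ T.powersetCard 3}

/-- Boundary faces are the mesh faces that lie on the boundary of `Ω`. -/
def IsBoundaryFace (M : MatchingTetMesh Ω) (F : M.Face) : Prop :=
  closedCell F.1 ⊆ frontier Ω

/-- The hybrid space `Y_h^{k+1}`: polynomials of degree at most `k` on the elements and of
degree at most `k + 1` on the faces. -/
abbrev HybridSpace (M : MatchingTetMesh Ω) (k : ℕ) : Type :=
  ((T : M.Elem) → polyOn k (openCell T.1)) × ((F : M.Face) → polyOn (k + 1) (closedCell F.1))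

/-- The subspace `Y_{h,0}^{k+1}` of hybrid vectors that vanish on all boundary faces. -/
def hybridSpaceZero (M : MatchingTetMesh Ω) (k : ℕ) : Submodule ℝ (M.HybridSpace k) where
  carrier := {q | ∀ F : M.Face, M.IsBoundaryFace F → q.2 F = 0}
  add_mem' := fun hq hr F hF => by simp [hq F hF, hr F hF]
  zero_mem' := fun F _ => rfl
  smul_mem' := fun c q hq F hF => by simp [hq F hF]

/-- The restriction of the global reconstruction to an element: the local reconstruction
applied to the restriction of the hybrid vector to this element. -/
noncomputable def gradOn (M : MatchingTetMesh Ω) {k : ℕ} (q : M.HybridSpace k) (T : M.Elem) :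
    vecPolyOn (k + 1) (openCell T.1) :=
  localGrad k (M.isTetrahedron T.1 T.2) (q.1 T) fun F => q.2 ⟨F.1, T.1, T.2, F.2⟩

open Classical in
/-- The global gradient reconstruction `G_h^{k+1} q`, a broken polynomial vector field: it is
equal to the local reconstruction on each element, and zero off the (disjoint) open elements. -/
noncomputable def grad (M : MatchingTetMesh Ω) {k : ℕ} (q : M.HybridSpace k) (x : E3) : E3 :=
  ∑ T : M.Elem, if hx : x ∈ openCell T.1 then (M.gradOn q T).1 ⟨x, hx⟩ else 0

/-- The `L²(Ω)` norm of the global gradient reconstruction. -/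
noncomputable def gradNorm (M : MatchingTetMesh Ω) {k : ℕ} (q : M.HybridSpace k) : ℝ :=
  (eLpNorm (M.grad q) 2 (volume.restrict Ω)).toReal

end MatchingTetMesh

/-! ### Polynomials -/

/-! Homogeneity and the triangle inequality are inherited from the `L²` norm, because the
reconstruction is linear by uniqueness in the local problem. The substance is definiteness: a hybrid
vector that vanishes on boundary faces and has zero local gradients is zero. Two local facts, valid
on an element `T` with zero gradient, come from test fields whose normal component vanishes on all
faces but one.

From a face to the element (`IsLocalGrad.cell_eq_zero`): let `qF = 0` on one face and let `v` be the
opposite vertex. The field `(x - v) p` is tangent to the three faces through `v`, and the fourth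
face contributes nothing, so `qT` is orthogonal to `div ((x - v) p)` for every `p` of degree at most
`k`. By Euler's identity this operator multiplies the leading part by `3 + degree` and otherwise
lowers the degree; it therefore reaches every polynomial of degree at most `k`
(`exists_radialDiv_eq`), in particular `qT`.

From the element to its faces (`IsLocalGrad.face_eq_zero`): let `qT = 0`, let `F` be the face
opposite `v`, `i` a vertex of `F` and `λᵢ` its barycentric coordinate. The field `λᵢ p (i - v)` has
zero normal component on every other face, which either contains the edge from `v` to `i` or lies in
the zero set of `λᵢ`. On `F` the normal component is a nonzero constant times `λᵢ p`. On `F` these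
products span the polynomials of degree at most `k + 1`, hence `qF = 0`.

Together, the elements with `qT ≠ 0` have no boundary face and form a set closed under passing to
face neighbours. Such a set is empty (`not_of_neighbour_closed`): on a line that starts inside one
of its elements and misses all mesh edges, consider the last point belonging to the set. It lies in
the relative interior of a face, and the two elements sharing that face, both in the set, cover a
neighbourhood of the point; so it is not the last. No connectedness of `Ω` is involved. -/

theorem polyDiv_mul_sub (v : E3) (p : MvPolynomial (Fin 3) ℝ) :
    polyDiv (fun j => (MvPolynomial.X j - MvPolynomial.C (v j)) * p)
      = (3 : ℝ) • p + ∑ j, MvPolynomial.X j * MvPolynomial.pderiv j p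
        - ∑ j, v j • MvPolynomial.pderiv j p := by
  simp only [polyDiv, Derivation.leibniz, map_sub, MvPolynomial.pderiv_X_self,
    MvPolynomial.pderiv_C, smul_eq_mul, mul_one, Fin.sum_univ_three, sub_mul,
    MvPolynomial.smul_eq_C_mul]
  have : (MvPolynomial.C (3 : ℝ) : MvPolynomial (Fin 3) ℝ) = 3 := map_ofNat _ 3
  rw [this]
  ring

/-- The map `p ↦ div ((x - v) p)`. -/
noncomputable def radialDiv (v : E3) : MvPolynomial (Fin 3) ℝ →ₗ[ℝ] MvPolynomial (Fin 3) ℝ where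
  toFun p := polyDiv (fun j => (MvPolynomial.X j - MvPolynomial.C (v j)) * p)
  map_add' p r := by
    rw [← polyDiv_add]
    congr 1
    funext j
    simp [mul_add]
  map_smul' c p := by
    rw [RingHom.id_apply, ← polyDiv_smul]
    congr 1
    funext j
    simp

theorem radialDiv_apply (v : E3) (p : MvPolynomial (Fin 3) ℝ) :
    radialDiv v p = (3 : ℝ) • p + ∑ j, MvPolynomial.X j * MvPolynomial.pderiv j p
      - ∑ j, v j • MvPolynomial.pderiv j p :=
  polyDiv_mul_sub v p

theorem radialDiv_monomial (v : E3) (m : Fin 3 →₀ ℕ) (c : ℝ) :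
    radialDiv v (MvPolynomial.monomial m c) = (3 + m.degree : ℝ) • MvPolynomial.monomial m c
      - ∑ j, v j • MvPolynomial.monomial (m - Finsupp.single j 1) (c * m j) := by
  have h := (MvPolynomial.isHomogeneous_monomial (σ := Fin 3) c (rfl : m.degree = m.degree))
    |>.sum_X_mul_pderiv
  rw [radialDiv_apply, h]
  simp only [MvPolynomial.pderiv_monomial, add_smul, Nat.cast_smul_eq_nsmul]

/-- On monomials `radialDiv v` is triangular with respect to degree, with diagonal entry `3 +
m.degree ≠ 0`, so it can be inverted by strong induction on the degree. -/
theorem monomial_mem_map_radialDiv (v : E3) (k : ℕ) (n : ℕ) :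
    ∀ m : Fin 3 →₀ ℕ, m.degree = n → n ≤ k → ∀ c : ℝ, MvPolynomial.monomial m c ∈
      (MvPolynomial.restrictTotalDegree (Fin 3) ℝ k).map (radialDiv v) := by
  induction n using Nat.strong_induction_on with
  | _ n ih =>
    intro m hm hn c
    have h0 : (3 + m.degree : ℝ) ≠ 0 := by positivity
    have h := radialDiv_monomial v m ((3 + m.degree : ℝ)⁻¹ * c)
    rw [MvPolynomial.smul_monomial, smul_eq_mul, mul_inv_cancel_left₀ h0] at h
    rw [← sub_eq_iff_eq_add.1 h.symm |>.trans (add_comm _ _) |>.symm]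
    refine Submodule.add_mem _ (Submodule.sum_mem _ fun j _ => Submodule.smul_mem _ _ ?_)
      (Submodule.mem_map_of_mem ?_)
    -- If `m j = 0`, the truncated difference `m - single j 1` is `m` itself and the degree does not
    -- drop, but the coefficient contains the factor `m j = 0`.
    · by_cases hj : m j = 0
      · simp [hj]
      · have hle : Finsupp.single j 1 ≤ m := by
          rw [Finsupp.single_le_iff]; omega
        have hd : (m - Finsupp.single j 1).degree + 1 = n := by
          rw [← hm]
          conv_rhs => rw [← tsub_add_cancel_of_le hle]
          simp [map_add]
        exact ih _ (by omega) _ rfl (by omega) _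
    · rw [MvPolynomial.mem_restrictTotalDegree]
      refine (MvPolynomial.totalDegree_monomial_le _ _).trans ?_
      change m.degree ≤ k
      omega

/-- Every polynomial of degree at most `k` is the divergence of `(x - v) p` for some polynomial
`p` of degree at most `k`. -/
theorem exists_radialDiv_eq (v : E3) {k : ℕ} {s : MvPolynomial (Fin 3) ℝ}
    (hs : s.totalDegree ≤ k) : ∃ p : MvPolynomial (Fin 3) ℝ, p.totalDegree ≤ k ∧
      polyDiv (fun j => (MvPolynomial.X j - MvPolynomial.C (v j)) * p) = s := by
  have h : s ∈ (MvPolynomial.restrictTotalDegree (Fin 3) ℝ k).map (radialDiv v) := by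
    rw [← MvPolynomial.support_sum_monomial_coeff s]
    refine Submodule.sum_mem _ fun m hm => monomial_mem_map_radialDiv v k _ m rfl ?_ _
    exact (MvPolynomial.le_totalDegree hm).trans hs
  obtain ⟨p, hp, h⟩ := h
  exact ⟨p, (MvPolynomial.mem_restrictTotalDegree _ _ _).1 hp, h⟩

theorem evalPt_mul (p r : MvPolynomial (Fin 3) ℝ) (x : E3) :
    evalPt (p * r) x = evalPt p x * evalPt r x := by simp [evalPt]

/-- The polynomial of an affine function. -/
noncomputable def affinePoly (f : E3 →ᵃ[ℝ] ℝ) : MvPolynomial (Fin 3) ℝ :=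
  MvPolynomial.C (f 0) + ∑ j, MvPolynomial.C (f.linear (EuclideanSpace.single j 1)) *
    MvPolynomial.X j

theorem evalPt_affinePoly (f : E3 →ᵃ[ℝ] ℝ) (x : E3) : evalPt (affinePoly f) x = f x := by
  have h1 : x = ∑ j, x j • (EuclideanSpace.single j 1 : E3) := by
    ext i
    fin_cases i <;> simp [Fin.sum_univ_three]
  have h2 : f x = f.linear x + f 0 := congrFun f.decomp x
  rw [h2]
  conv_rhs => rw [h1]
  simp only [map_sum, map_smul, smul_eq_mul, evalPt, affinePoly, map_add, map_mul,
    MvPolynomial.eval_C, MvPolynomial.eval_X]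
  rw [add_comm]
  simp only [mul_comm]

theorem totalDegree_affinePoly_le (f : E3 →ᵃ[ℝ] ℝ) : (affinePoly f).totalDegree ≤ 1 := by
  refine (MvPolynomial.totalDegree_add _ _).trans (max_le (by simp) ?_)
  refine MvPolynomial.totalDegree_finsetSum_le fun j _ => ?_
  refine (MvPolynomial.totalDegree_mul _ _).trans ?_
  simp

/-! ### Barycentric coordinates -/

/-- The affine basis formed by the vertices of a tetrahedron. -/
noncomputable def IsTetrahedron.basis {T : Finset E3} (hT : IsTetrahedron T) :
    AffineBasis T ℝ E3 where
  toFun := (↑)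
  ind' := hT.2
  tot' := (hT.2.affineSpan_eq_top_iff_card_eq_finrank_add_one).2 (by simp [hT.1])

@[simp] theorem IsTetrahedron.basis_apply {T : Finset E3} (hT : IsTetrahedron T) (a : T) :
    hT.basis a = a := rfl

theorem IsTetrahedron.range_basis {T : Finset E3} (hT : IsTetrahedron T) :
    Set.range hT.basis = (T : Set E3) := by
  ext x
  simp

theorem IsTetrahedron.mem_closedCell {T : Finset E3} (hT : IsTetrahedron T) {x : E3} :
    x ∈ closedCell T ↔ ∀ i, 0 ≤ hT.basis.coord i x := by
  rw [closedCell, ← hT.range_basis, hT.basis.convexHull_eq_nonneg_coord]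
  rfl

theorem IsTetrahedron.coord_self {T : Finset E3} (hT : IsTetrahedron T) (a : T) :
    hT.basis.coord a a = 1 :=
  hT.basis.coord_apply_eq a

theorem IsTetrahedron.coord_of_ne {T : Finset E3} (hT : IsTetrahedron T) {a b : T} (h : a ≠ b) :
    hT.basis.coord a b = 0 :=
  hT.basis.coord_apply_ne h

theorem IsTetrahedron.sum_coord_smul {T : Finset E3} (hT : IsTetrahedron T) (x : E3) :
    ∑ i : T, hT.basis.coord i x • (i : E3) = x :=
  hT.basis.linear_combination_coord_eq_self x

theorem convex_affine_nonneg (f : E3 →ᵃ[ℝ] ℝ) : Convex ℝ {x | 0 ≤ f x} :=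
  (convex_Ici (0 : ℝ)).affine_preimage f

theorem affine_nonneg_of_mem_convexHull {S : Set E3} {f : E3 →ᵃ[ℝ] ℝ} (hf : ∀ y ∈ S, 0 ≤ f y)
    {x : E3} (hx : x ∈ convexHull ℝ S) : 0 ≤ f x :=
  convexHull_min hf (convex_affine_nonneg f) hx

theorem affine_eq_zero_of_mem_convexHull {S : Set E3} {f : E3 →ᵃ[ℝ] ℝ} (hf : ∀ y ∈ S, f y = 0)
    {x : E3} (hx : x ∈ convexHull ℝ S) : f x = 0 := by
  refine convexHull_min (t := {x | f x = 0}) hf ?_ hx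
  exact (convex_singleton (0 : ℝ)).affine_preimage f

theorem IsTetrahedron.coord_eq_zero {T : Finset E3} (hT : IsTetrahedron T) {S : Set E3}
    (hS : S ⊆ T) {a : T} (ha : (a : E3) ∉ S) {x : E3} (hx : x ∈ convexHull ℝ S) :
    hT.basis.coord a x = 0 :=
  affine_eq_zero_of_mem_convexHull
    (fun y hy => hT.coord_of_ne (b := ⟨y, hS hy⟩) fun h => ha (by rw [h]; exact hy)) hx

theorem IsTetrahedron.mem_convexHull {T : Finset E3} (hT : IsTetrahedron T) {S : Set E3}
    {x : E3} (hx : x ∈ closedCell T) (h : ∀ a : T, (a : E3) ∉ S → hT.basis.coord a x = 0) :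
    x ∈ convexHull ℝ S := by
  classical
  have h1 : ∑ i ∈ Finset.univ.filter (fun i : T => (i : E3) ∈ S), hT.basis.coord i x = 1 := by
    rw [Finset.sum_filter_of_ne, hT.basis.sum_coord_apply_eq_one]
    intro i _ hi
    by_contra hS
    exact hi (h i hS)
  have h2 : ∑ i ∈ Finset.univ.filter (fun i : T => (i : E3) ∈ S), hT.basis.coord i x • (i : E3) = x := by
    rw [Finset.sum_filter_of_ne, hT.sum_coord_smul]
    intro i _ hi
    by_contra hS
    exact hi (by rw [h i hS, zero_smul])
  rw [← h2]
  exact (convex_convexHull ℝ S).sum_mem (fun i _ => hT.mem_closedCell.1 hx i) h1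
    fun i hi => subset_convexHull ℝ S (Finset.mem_filter.1 hi).2

theorem eq_erase_of_mem_powersetCard {T F : Finset E3} (hT : T.card = 4)
    (hF : F ∈ T.powersetCard 3) {a : E3} (ha : a ∈ T) (haF : a ∉ F) : F = T.erase a := by
  obtain ⟨h1, h2⟩ := Finset.mem_powersetCard.1 hF
  refine Finset.eq_of_subset_of_card_le (fun x hx => Finset.mem_erase.2 ⟨?_, h1 hx⟩) ?_
  · rintro rfl; exact haF hx
  · rw [Finset.card_erase_of_mem ha]; omega

theorem exists_notMem_of_mem_powersetCard {T F : Finset E3} (hT : T.card = 4)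
    (hF : F ∈ T.powersetCard 3) : ∃ a ∈ T, a ∉ F := by
  obtain ⟨h1, h2⟩ := Finset.mem_powersetCard.1 hF
  exact Finset.exists_mem_notMem_of_card_lt_card (by omega)

theorem inner_outwardNormal_eq_zero {T F : Finset E3} (hT : IsTetrahedron T)
    (hF : F ∈ T.powersetCard 3) {v x : E3} (hv : v ∈ F) (hx : x ∈ closedCell F) :
    ⟪x - v, outwardNormal T F⟫ = 0 := by
  have h1 : x ∈ affineSpan ℝ (F : Set E3) := convexHull_subset_affineSpan _ hx
  have h2 : x - v ∈ vectorSpan ℝ (F : Set E3) := by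
    rw [← direction_affineSpan]
    exact AffineSubspace.vsub_mem_direction h1 (subset_affineSpan ℝ _ hv)
  exact (Submodule.mem_orthogonal _ _).1 (outwardNormal_spec hT hF).2.1 _ h2

/-! ### Vanishing of a field with vanishing moments -/

theorem evalVec_mul_sub (v : E3) (p : MvPolynomial (Fin 3) ℝ) (x : E3) :
    evalVec (fun j => (MvPolynomial.X j - MvPolynomial.C (v j)) * p) x = evalPt p x • (x - v) := by
  ext i
  simp [evalVec, evalPt, mul_comm]

theorem evalVec_smul_const (p : MvPolynomial (Fin 3) ℝ) (t x : E3) :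
    evalVec (fun j => t j • p) x = evalPt p x • t := by
  ext i
  simp [evalVec, evalPt, mul_comm, MvPolynomial.smul_eval]

theorem eq_zero_on_openCell_of_integral_sq {T : Finset E3} {P : E3 → ℝ} (hP : Continuous P)
    (h : intCell T (fun x => P x * P x) = 0) : ∀ x ∈ openCell T, P x = 0 := by
  have hm : MeasurableSet (openCell T) := isOpen_interior.measurableSet
  have h1 : (fun x => P x * P x) =ᵐ[volume.restrict (openCell T)] (0 : E3 → ℝ) := by
    rw [← setIntegral_eq_zero_iff_of_nonneg_ae (ae_of_all _ fun x => mul_self_nonneg _)]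
    · rw [intCell] at h
      rw [← h, ← map_comap_subtype_coe hm, (MeasurableEmbedding.subtype_coe hm).integral_map]
    · rw [IntegrableOn, ← map_comap_subtype_coe hm,
        (MeasurableEmbedding.subtype_coe hm).integrable_map_iff]
      exact integrable_cell T (hP.mul hP)
  have h2 := Measure.eqOn_open_of_ae_eq h1 isOpen_interior (hP.mul hP).continuousOn
    continuousOn_const
  exact fun x hx => mul_self_eq_zero.1 (h2 hx)

/-- The element unknown vanishes if the reconstructed gradient does, and one of the face unknowns
does. -/
theorem IsLocalGrad.cell_eq_zero {k : ℕ} {T : Finset E3} (hT : IsTetrahedron T)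
    {qT : polyOn k (openCell T)} {qF : (F : FacesOf T) → polyOn (k + 1) (closedCell F.1)}
    (h : IsLocalGrad k T qT qF 0) (F : FacesOf T) (hF : qF F = 0) : qT = 0 := by
  obtain ⟨s, hs, hqs⟩ := qT.2
  obtain ⟨v, hvT, hvF⟩ := exists_notMem_of_mem_powersetCard hT.1 F.2
  obtain ⟨p, hp, hdiv⟩ := exists_radialDiv_eq v hs
  -- `v` is the vertex opposite `F` and `p` is chosen so that this test field has divergence `s`,
  -- the polynomial representing `qT`.
  have h1 := h (fun j => (MvPolynomial.X j - MvPolynomial.C (v j)) * p) fun j => by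
    refine (MvPolynomial.totalDegree_mul _ _).trans ?_
    have := MvPolynomial.totalDegree_sub_C_le (MvPolynomial.X j : MvPolynomial (Fin 3) ℝ) (v j)
    rw [MvPolynomial.totalDegree_X] at this
    omega
  have h2 : ∀ G : FacesOf T, intFace G.1 (fun x => (qF G).1 x *
      ⟪evalVec (fun j => (MvPolynomial.X j - MvPolynomial.C (v j)) * p) x,
        outwardNormal T G.1⟫) = 0 := by
    intro G
    have h0 : ∀ x : closedCell G.1, (qF G).1 x *
      ⟪evalVec (fun j => (MvPolynomial.X j - MvPolynomial.C (v j)) * p) x,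
        outwardNormal T G.1⟫ = 0 := by
      intro x
      by_cases hv : v ∈ G.1
      · rw [evalVec_mul_sub, real_inner_smul_left, inner_outwardNormal_eq_zero hT G.2 hv x.2]
        simp
      · have : G = F := Subtype.ext ((eq_erase_of_mem_powersetCard hT.1 G.2 hvT hv).trans
          (eq_erase_of_mem_powersetCard hT.1 F.2 hvT hvF).symm)
        subst this
        simp [hF]
    simp [intFace, h0]
  simp only [h2, hdiv, Finset.sum_const_zero, add_zero, hqs] at h1
  have h3 : intCell T (fun x => evalPt s x * evalPt s x) = 0 := by
    have : intCell T (fun x => ⟪(0 : vecPolyOn (k + 1) (openCell T)).1 x,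
      evalVec (fun j => (MvPolynomial.X j - MvPolynomial.C (v j)) * p) x⟫) = 0 := by
      simp [intCell]
    rw [this] at h1
    linarith
  have h4 := eq_zero_on_openCell_of_integral_sq (continuous_evalPt s) h3
  ext x
  rw [hqs, h4 x x.2]
  rfl

/-! ### Relatively open subsets of a face have positive surface measure -/

theorem interior_standardTriangle_nonempty :
    (interior (convexHull ℝ ({!₂[0, 0], !₂[1, 0], !₂[0, 1]} : Set (EuclideanSpace ℝ (Fin 2))))).Nonempty := by
  have hne : (!₂[0, 0] : EuclideanSpace ℝ (Fin 2)) ∈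
      ({!₂[0, 0], !₂[1, 0], !₂[0, 1]} : Set (EuclideanSpace ℝ (Fin 2))) := by simp
  rw [interior_convexHull_nonempty_iff_affineSpan_eq_top,
    AffineSubspace.affineSpan_eq_top_iff_vectorSpan_eq_top_of_nonempty ℝ _ _ ⟨_, hne⟩, eq_top_iff]
  intro x _
  have h1 : (!₂[1, 0] : EuclideanSpace ℝ (Fin 2)) - !₂[0, 0] ∈
      vectorSpan ℝ ({!₂[0, 0], !₂[1, 0], !₂[0, 1]} : Set (EuclideanSpace ℝ (Fin 2))) :=
    vsub_mem_vectorSpan ℝ (by simp) hne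
  have h2 : (!₂[0, 1] : EuclideanSpace ℝ (Fin 2)) - !₂[0, 0] ∈
      vectorSpan ℝ ({!₂[0, 0], !₂[1, 0], !₂[0, 1]} : Set (EuclideanSpace ℝ (Fin 2))) :=
    vsub_mem_vectorSpan ℝ (by simp) hne
  have h3 : x = x 0 • ((!₂[1, 0] : EuclideanSpace ℝ (Fin 2)) - !₂[0, 0])
      + x 1 • ((!₂[0, 1] : EuclideanSpace ℝ (Fin 2)) - !₂[0, 0]) := by
    ext i
    fin_cases i <;> simp
  rw [h3]
  exact Submodule.add_mem _ (Submodule.smul_mem _ _ h1) (Submodule.smul_mem _ _ h2)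

/-- The triangle is the image of the reference triangle under an affine map, injective by affine
independence and hence antilipschitz. Such a map shrinks Hausdorff measure at most by a constant
factor, and in the plane nonempty open sets have positive measure. -/
theorem surface_pos {F : Finset E3} (hF : F.card = 3) (hind : AffineIndependent ℝ ((↑) : F → E3))
    {U : Set E3} (hU : IsOpen U) (hne : (U ∩ closedCell F).Nonempty) :
    0 < (μHE[2] : Measure E3) (U ∩ closedCell F) := by
  classical
  obtain ⟨a, b, c, hab, hac, hbc, rfl⟩ := Finset.card_eq_three.mp hF
  let l : EuclideanSpace ℝ (Fin 2) →L[ℝ] E3 :=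
    (EuclideanSpace.proj (0 : Fin 2) : EuclideanSpace ℝ (Fin 2) →L[ℝ] ℝ).smulRight (b - a)
    + (EuclideanSpace.proj (1 : Fin 2) : EuclideanSpace ℝ (Fin 2) →L[ℝ] ℝ).smulRight (c - a)
  let A : EuclideanSpace ℝ (Fin 2) →ᵃ[ℝ] E3 :=
    l.toLinearMap.toAffineMap + AffineMap.const ℝ _ a
  let S : Set (EuclideanSpace ℝ (Fin 2)) := {!₂[0, 0], !₂[1, 0], !₂[0, 1]}
  have hS : closedCell {a, b, c} = A '' convexHull ℝ S := by
    rw [A.image_convexHull]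
    simp [closedCell, S, A, l, Set.image_insert_eq]
  -- A kernel vector `x` gives the affine relation among `a`, `b`, `c` with weights `-(x 0 + x 1)`,
  -- `x 0`, `x 1`, whose sum is zero.
  have hker : l.toLinearMap.ker = ⊥ := by
    rw [LinearMap.ker_eq_bot']
    intro x hx
    have hx' : x 0 • (b - a) + x 1 • (c - a) = 0 := by simpa [l] using hx
    have h0 := affineIndependent_iff.1 hind Finset.univ
      (fun i => if (i : E3) = a then -(x 0 + x 1) else if (i : E3) = b then x 0 else x 1)
    have hsum : ∀ f : E3 → ℝ, ∑ i : ({a, b, c} : Finset E3), f i = f a + (f b + f c) := by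
      intro f
      rw [Finset.sum_coe_sort ({a, b, c} : Finset E3) f, Finset.sum_insert (by simp [hab, hac]),
        Finset.sum_pair hbc]
    have hsum' : ∀ f : E3 → E3, ∑ i : ({a, b, c} : Finset E3), f i = f a + (f b + f c) := by
      intro f
      rw [Finset.sum_coe_sort ({a, b, c} : Finset E3) f, Finset.sum_insert (by simp [hab, hac]),
        Finset.sum_pair hbc]
    have h1 := h0
      (by
        rw [hsum fun y => if y = a then -(x 0 + x 1) else if y = b then x 0 else x 1]
        simp [hab.symm, hac.symm, hbc.symm])
      (by
        rw [hsum' fun y => (if y = a then -(x 0 + x 1) else if y = b then x 0 else x 1) • y]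
        simp only [if_true, hab.symm, hac.symm, hbc.symm, if_false]
        rw [← hx']
        module)
    have hb := h1 ⟨b, by simp⟩ (Finset.mem_univ _)
    have hc := h1 ⟨c, by simp⟩ (Finset.mem_univ _)
    simp [hab.symm, hac.symm, hbc.symm] at hb hc
    ext i
    fin_cases i <;> simp [hb, hc]
  obtain ⟨K, hK, hanti⟩ := l.toLinearMap.exists_antilipschitzWith hker
  have hA : AntilipschitzWith K A := by
    intro x y
    have := hanti x y
    simpa [A] using this
  have hAc : Continuous A := by
    have : Continuous fun x => l x + a := l.continuous.add continuous_const
    exact this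
  have hpos : 0 < (μH[(2 : ℕ)] : Measure (EuclideanSpace ℝ (Fin 2)))
      (A ⁻¹' U ∩ interior (convexHull ℝ S)) := by
    refine ((hU.preimage hAc).inter isOpen_interior).measure_pos _ ?_
    obtain ⟨y, hyU, hy⟩ := hne
    rw [hS] at hy
    obtain ⟨x, hx, rfl⟩ := hy
    -- `U` may be known to meet the triangle only at a boundary point; a convex set with nonempty
    -- interior lies in the closure of that interior.
    have hx' : x ∈ closure (interior (convexHull ℝ S)) := by
      rw [(convex_convexHull ℝ S).closure_interior_eq_closure_of_nonempty_interior
        interior_standardTriangle_nonempty]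
      exact subset_closure hx
    exact mem_closure_iff.1 hx' _ (hU.preimage hAc) hyU
  have hle := hA.le_hausdorffMeasure_image (d := ((2 : ℕ) : ℝ)) (by simp)
    (A ⁻¹' U ∩ interior (convexHull ℝ S))
  have hsub : A '' (A ⁻¹' U ∩ interior (convexHull ℝ S)) ⊆ U ∩ closedCell {a, b, c} := by
    rw [hS]
    rintro _ ⟨x, ⟨hx1, hx2⟩, rfl⟩
    exact ⟨hx1, x, interior_subset hx2, rfl⟩
  rw [Measure.euclideanHausdorffMeasure_def, Measure.smul_apply, ENNReal.smul_def, smul_eq_mul]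
  refine ENNReal.mul_pos ?_ ?_
  · have : (volume : Measure (EuclideanSpace ℝ (Fin 2))).addHaarScalarFactor μH[(2 : ℕ)] ≠ 0 :=
      (Measure.addHaarScalarFactor_pos_of_isAddHaarMeasure _ _).ne'
    simpa using this
  · intro h0
    have h1 := measure_mono_null hsub h0
    rw [h1, mul_zero] at hle
    exact hpos.ne' (le_antisymm hle bot_le)

theorem eq_zero_on_closedCell_of_integral_sq {F : Finset E3} (hF : F.card = 3)
    (hind : AffineIndependent ℝ ((↑) : F → E3)) {P : E3 → ℝ} (hP : Continuous P)
    (h : intFace F (fun x => P x * P x) = 0) : ∀ x ∈ closedCell F, P x = 0 := by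
  have hm : MeasurableSet (closedCell F) := (isCompact_closedCell F).measurableSet
  have h1 : (fun x => P x * P x) =ᵐ[(μHE[2] : Measure E3).restrict (closedCell F)]
      (0 : E3 → ℝ) := by
    rw [← setIntegral_eq_zero_iff_of_nonneg_ae (ae_of_all _ fun x => mul_self_nonneg _)]
    · rw [intFace] at h
      rw [← h, ← map_comap_subtype_coe hm, (MeasurableEmbedding.subtype_coe hm).integral_map]
    · rw [IntegrableOn, ← map_comap_subtype_coe hm,
        (MeasurableEmbedding.subtype_coe hm).integrable_map_iff]
      exact integrable_face hF (hP.mul hP)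
  intro x hx
  by_contra hne
  have hU : IsOpen {y | P y ≠ 0} := isOpen_ne_fun hP continuous_const
  refine (surface_pos hF hind hU ⟨x, hne, hx⟩).ne' ?_
  rw [← Measure.restrict_apply hU.measurableSet]
  refine measure_mono_null (fun y hy => ?_) h1
  simpa using hy

/-! ### Vanishing of the face unknowns -/

theorem AffineIndependent.of_mem_powersetCard {T F : Finset E3} (hT : IsTetrahedron T)
    (hF : F ∈ T.powersetCard 3) : AffineIndependent ℝ ((↑) : F → E3) :=
  hT.2.mono (s := (F : Set E3)) (t := (T : Set E3)) (Finset.mem_powersetCard.1 hF).1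

/-- A moment of a face unknown against a multiple of a barycentric coordinate. -/
theorem IsLocalGrad.intFace_mul_coord {k : ℕ} {T : Finset E3} (hT : IsTetrahedron T)
    {qF : (F : FacesOf T) → polyOn (k + 1) (closedCell F.1)}
    (h : IsLocalGrad k T 0 qF 0) (F : FacesOf T) {i : T} (hi : (i : E3) ∈ F.1)
    {p : MvPolynomial (Fin 3) ℝ} (hp : p.totalDegree ≤ k) :
    intFace F.1 (fun x => (qF F).1 x * (hT.basis.coord i x * evalPt p x)) = 0 := by
  obtain ⟨v, hvT, hvF⟩ := exists_notMem_of_mem_powersetCard hT.1 F.2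
  set s := affinePoly (hT.basis.coord i) * p with hs
  have hes : ∀ x, evalPt s x = hT.basis.coord i x * evalPt p x := fun x => by
    rw [hs, evalPt_mul, evalPt_affinePoly]
  -- The constant direction from `v` to `i` is transversal to `F` and tangent to the other faces
  -- containing `i`. The factor `s`, of degree at most `k + 1`, takes care of the face that misses
  -- `i`.
  have h1 := h (fun j => ((i : E3) - v) j • s) fun j => by
    refine (MvPolynomial.totalDegree_smul_le _ _).trans
      ((MvPolynomial.totalDegree_mul _ _).trans ?_)
    have := totalDegree_affinePoly_le (hT.basis.coord i)
    omega
  have hL : intCell T (fun x => ⟪(0 : vecPolyOn (k + 1) (openCell T)).1 x,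
      evalVec (fun j => ((i : E3) - v) j • s) x⟫) = 0 := by simp [intCell]
  have hR : intCell T (fun x => (0 : polyOn k (openCell T)).1 x *
      evalPt (polyDiv fun j => ((i : E3) - v) j • s) x) = 0 := by simp [intCell]
  rw [hL, hR, neg_zero, zero_add, Finset.sum_eq_single F] at h1
  · have h2 : ∀ x : closedCell F.1, (qF F).1 x *
        ⟪evalVec (fun j => ((i : E3) - v) j • s) x, outwardNormal T F.1⟫
        = ⟪outwardNormal T F.1, (i : E3) - v⟫ *
          ((qF F).1 x * (hT.basis.coord i x * evalPt p x)) := by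
      intro x
      rw [evalVec_smul_const, real_inner_smul_left, hes, real_inner_comm]
      ring
    simp only [h2, intFace] at h1
    rw [integral_const_mul] at h1
    exact (mul_eq_zero.1 h1.symm).resolve_left
      ((outwardNormal_spec hT F.2).2.2 v hvT hvF i hi).ne'
  · intro G _ hG
    have hvG : v ∈ G.1 := by
      by_contra hvG
      exact hG (Subtype.ext ((eq_erase_of_mem_powersetCard hT.1 G.2 hvT hvG).trans
          (eq_erase_of_mem_powersetCard hT.1 F.2 hvT hvF).symm))
    have h0 : ∀ x : closedCell G.1, (qF G).1 x *
        ⟪evalVec (fun j => ((i : E3) - v) j • s) x, outwardNormal T G.1⟫ = 0 := by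
      intro x
      rw [evalVec_smul_const, real_inner_smul_left]
      by_cases hiG : (i : E3) ∈ G.1
      · rw [inner_outwardNormal_eq_zero hT G.2 hvG (subset_convexHull ℝ _ hiG)]
        simp
      · rw [hes, hT.coord_eq_zero (Finset.coe_subset.2 (Finset.mem_powersetCard.1 G.2).1) hiG x.2]
        simp
    simp only [intFace, h0, integral_zero]
  · simp

theorem intFace_finsetSum {F : Finset E3} (hF : F.card = 3) {ι : Type*} (s : Finset ι)
    {f : ι → E3 → ℝ} (hf : ∀ i ∈ s, Continuous (f i)) :
    intFace F (fun x => ∑ i ∈ s, f i x) = ∑ i ∈ s, intFace F (fun x => f i x) :=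
  integral_finsetSum s fun i hi => integrable_face hF (hf i hi)

/-- The face unknowns vanish if the reconstructed gradient and the element unknown do. -/
theorem IsLocalGrad.face_eq_zero {k : ℕ} {T : Finset E3} (hT : IsTetrahedron T)
    {qF : (F : FacesOf T) → polyOn (k + 1) (closedCell F.1)}
    (h : IsLocalGrad k T 0 qF 0) (F : FacesOf T) : qF F = 0 := by
  have hF : F.1.card = 3 := (Finset.mem_powersetCard.1 F.2).2
  have hFT : F.1 ⊆ T := (Finset.mem_powersetCard.1 F.2).1
  obtain ⟨r, hr, hq⟩ := (qF F).2
  have hcoord : ∀ i : T, Continuous (hT.basis.coord i) := fun i =>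
    AffineMap.continuous_of_finiteDimensional _
  have hmul : ∀ (i : T) (p : MvPolynomial (Fin 3) ℝ), p.totalDegree ≤ k →
      intFace F.1 (fun x => evalPt r x * (hT.basis.coord i x * evalPt p x)) = 0 := by
    intro i p hp
    by_cases hi : (i : E3) ∈ F.1
    · have := h.intFace_mul_coord hT F hi hp
      simpa only [hq] using this
    · have h0 : ∀ x : closedCell F.1, evalPt r x * (hT.basis.coord i x * evalPt p x) = 0 := by
        intro x
        rw [hT.coord_eq_zero (Finset.coe_subset.2 hFT) hi x.2]
        simp
      simp [intFace, h0]
  have hcomb : ∀ (c : T → ℝ) (p : MvPolynomial (Fin 3) ℝ), p.totalDegree ≤ k →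
      intFace F.1 (fun x => ∑ i : T, c i *
        (evalPt r x * (hT.basis.coord i x * evalPt p x))) = 0 := by
    intro c p hp
    rw [intFace_finsetSum hF (f := fun i x => c i * (evalPt r x *
      (hT.basis.coord i x * evalPt p x))) _ fun i _ => continuous_const.mul
      ((continuous_evalPt r).mul ((hcoord i).mul (continuous_evalPt p)))]
    refine Finset.sum_eq_zero fun i _ => ?_
    have := hmul i p hp
    simp only [intFace] at this ⊢
    rw [integral_const_mul, this, mul_zero]
  -- Every monomial is a combination of products `λᵢ p` with `p` of degree at most `k`: a constant
  -- is multiplied by `∑ λᵢ = 1`, and from any other monomial one factor `X j = ∑ λᵢ (i j)` is split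
  -- off.
  have hmon : ∀ (m : Fin 3 →₀ ℕ) (c : ℝ), m.degree ≤ k + 1 →
      intFace F.1 (fun x => evalPt r x * evalPt (MvPolynomial.monomial m c) x) = 0 := by
    intro m c hm
    by_cases hm0 : m = 0
    · rw [← hcomb 1 (MvPolynomial.C c) (by simp)]
      congr 1
      funext x
      subst hm0
      have h1 := hT.basis.sum_coord_apply_eq_one x
      simp only [evalPt, Pi.one_apply, one_mul, MvPolynomial.eval_C, MvPolynomial.monomial_zero']
      rw [← Finset.mul_sum, ← Finset.sum_mul, h1, one_mul]
    · obtain ⟨j, hj⟩ := Finsupp.ne_iff.1 hm0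
      have hle : Finsupp.single j 1 ≤ m := by
        rw [Finsupp.single_le_iff]
        exact Nat.one_le_iff_ne_zero.2 (by simpa using hj)
      have hd : (m - Finsupp.single j 1).degree + 1 = m.degree := by
        conv_rhs => rw [← tsub_add_cancel_of_le hle]
        simp [map_add]
      have hmon : MvPolynomial.monomial m c =
          MvPolynomial.X j * MvPolynomial.monomial (m - Finsupp.single j 1) c := by
        rw [MvPolynomial.X, MvPolynomial.monomial_mul, one_mul, add_tsub_cancel_of_le hle]
      rw [← hcomb (fun i => (i : E3) j) (MvPolynomial.monomial (m - Finsupp.single j 1) c)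
        ((MvPolynomial.totalDegree_monomial_le _ _).trans (by
          change (m - Finsupp.single j 1).degree ≤ k
          omega))]
      congr 1
      funext x
      have h1 : x.1 j = ∑ i : T, hT.basis.coord i x * (i : E3) j := by
        conv_lhs => rw [← hT.sum_coord_smul x]
        simp
      have h2 : evalPt (MvPolynomial.X j) (x : E3) = x.1 j := by simp [evalPt]
      rw [hmon, evalPt_mul, h2, h1, Finset.sum_mul, Finset.mul_sum]
      exact Finset.sum_congr rfl fun i _ => by ring
  have hsq : intFace F.1 (fun x => evalPt r x * evalPt r x) = 0 := by
    have h1 : ∀ x : E3, evalPt r x * evalPt r x = ∑ m ∈ r.support,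
        evalPt r x * evalPt (MvPolynomial.monomial m (r.coeff m)) x := by
      intro x
      rw [← Finset.mul_sum]
      congr 1
      have := congrArg (fun p => evalPt p x) (MvPolynomial.support_sum_monomial_coeff r)
      simp only [evalPt, map_sum] at this ⊢
      exact this.symm
    simp only [h1]
    rw [intFace_finsetSum hF (f := fun m x => evalPt r x *
      evalPt (MvPolynomial.monomial m (r.coeff m)) x) _ fun m _ =>
      (continuous_evalPt _).mul (continuous_evalPt _)]
    exact Finset.sum_eq_zero fun m hm => hmon m _ ((MvPolynomial.le_totalDegree hm).trans hr)
  have hz := eq_zero_on_closedCell_of_integral_sq hF (.of_mem_powersetCard hT F.2)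
    (continuous_evalPt r) hsq
  ext x
  rw [hq, hz x x.2]
  rfl

/-! ### Face neighbours and propagation through the mesh -/

open Filter Topology

theorem closedCell_mono {S T : Finset E3} (h : S ⊆ T) : closedCell S ⊆ closedCell T :=
  convexHull_mono (Finset.coe_subset.2 h)

namespace MatchingTetMesh

variable {Ω : Set E3}

theorem closedCell_subset (M : MatchingTetMesh Ω) {T : Finset E3} (hT : T ∈ M.elems) :
    closedCell T ⊆ closure Ω := by
  rw [M.cover]
  exact Set.subset_biUnion_of_mem (u := fun T => closedCell T) hT

/-- A face that is not contained in the boundary has an element on its other side. -/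
theorem exists_neighbour (M : MatchingTetMesh Ω) (hΩ : IsOpen Ω) {T : Finset E3}
    (hT : T ∈ M.elems) (a : T) (hF : ¬ closedCell (T.erase a) ⊆ frontier Ω) :
    ∃ T' ∈ M.elems, T.erase a ⊆ T' ∧
      ∃ b ∈ T', b ∉ T.erase a ∧ (M.isTetrahedron T hT).basis.coord a b < 0 := by
  have hTet := M.isTetrahedron T hT
  obtain ⟨x, hxF, hx⟩ := Set.not_subset.1 hF
  have hxΩ : x ∈ Ω := by
    have h1 : x ∈ closure Ω :=
      M.closedCell_subset hT (closedCell_mono (Finset.erase_subset _ _) hxF)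
    by_contra h
    exact hx ⟨h1, by rwa [hΩ.interior_eq]⟩
  have hxT := hTet.mem_closedCell.1 (closedCell_mono (Finset.erase_subset _ _) hxF)
  have hxa : hTet.basis.coord a x = 0 :=
    hTet.coord_eq_zero (S := (T.erase (a : E3) : Set E3)) (by simp) (by simp) hxF
  -- a point `y` of `Ω` in the relative interior of the face
  set F := T.erase (a : E3) with hFdef
  have hFT : F ⊆ T := Finset.erase_subset _ _
  -- `g` is the barycentre of the face. The point `x` may lie on an edge; a small move towards `g`
  -- stays in `Ω` and makes the three remaining coordinates positive.
  obtain ⟨g, hga, hg⟩ : ∃ g : E3, hTet.basis.coord a g = 0 ∧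
      ∀ i : T, i ≠ a → 0 < hTet.basis.coord i g := by
    have hc : (Finset.univ.erase a).Nonempty := by
      rw [← Finset.card_pos, Finset.card_erase_of_mem (Finset.mem_univ _)]
      simp [hTet.1]
    have hcard : ∑ i ∈ Finset.univ.erase a,
        (Finset.univ.erase a).centroidWeights ℝ i = 1 :=
      Finset.sum_centroidWeights_eq_one_of_nonempty ℝ _ hc
    refine ⟨(Finset.univ.erase a).affineCombination ℝ hTet.basis
      ((Finset.univ.erase a).centroidWeights ℝ), ?_, fun i hi => ?_⟩
    · rw [hTet.basis.coord_apply_combination_of_notMem (by simp) hcard]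
    · rw [hTet.basis.coord_apply_combination_of_mem (by simp [hi]) hcard,
        Finset.centroidWeights_apply]
      exact inv_pos.2 (Nat.cast_pos.2 (Finset.card_pos.2 hc))
  have hlim : Tendsto (fun s : ℝ => AffineMap.lineMap x g s) (𝓝[>] 0) (𝓝 x) := by
    have : Continuous fun s : ℝ => AffineMap.lineMap x g s := AffineMap.lineMap_continuous
    have h := this.tendsto 0
    rw [AffineMap.lineMap_apply_zero] at h
    exact h.mono_left nhdsWithin_le_nhds
  obtain ⟨s, hsΩ, hs⟩ := ((hlim.eventually (hΩ.mem_nhds hxΩ)).and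
    (Ioo_mem_nhdsGT (show (0 : ℝ) < 1 by norm_num))).exists
  set y := AffineMap.lineMap x g s with hy
  have hcy : ∀ i, hTet.basis.coord i y
      = (1 - s) * hTet.basis.coord i x + s * hTet.basis.coord i g := by
    intro i
    rw [hy, AffineMap.apply_lineMap, AffineMap.lineMap_apply_module]
    rfl
  have hya : hTet.basis.coord a y = 0 := by rw [hcy, hxa, hga]; ring
  have hyi : ∀ i : T, i ≠ a → 0 < hTet.basis.coord i y := fun i hi => by
    rw [hcy]
    exact add_pos_of_nonneg_of_pos (mul_nonneg (by linarith [hs.2]) (hxT i))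
      (mul_pos hs.1 (hg i hi))
  have hyT : y ∈ closedCell T := hTet.mem_closedCell.2 fun i => by
    by_cases hi : i = a
    · rw [hi, hya]
    · exact (hyi i hi).le
  -- points on the other side of the face
  let z : ℝ → E3 := fun ε => AffineMap.lineMap y (a : E3) (-ε)
  have hzc : Continuous z := by
    have : Continuous fun s : ℝ => AffineMap.lineMap y (a : E3) s := AffineMap.lineMap_continuous
    exact this.comp continuous_neg
  have hz : Tendsto z (𝓝[>] 0) (𝓝 y) := by
    have h := hzc.tendsto 0
    simp only [z, neg_zero, AffineMap.lineMap_apply_zero] at h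
    exact h.mono_left nhdsWithin_le_nhds
  have hza : ∀ ε, hTet.basis.coord a (z ε) = -ε := by
    intro ε
    simp only [z]
    rw [AffineMap.apply_lineMap, hya, hTet.coord_self, AffineMap.lineMap_apply_module]
    simp
  -- For small `ε` the points `z ε` lie in `Ω`, which finitely many closed cells cover, so one cell
  -- contains `z ε` for arbitrarily small `ε`; being closed, it also contains `y`.
  obtain ⟨T', hT', hfreq⟩ : ∃ T' ∈ M.elems, ∃ᶠ ε in 𝓝[>] (0 : ℝ), z ε ∈ closedCell T' := by
    by_contra! h
    have h1 : ∀ᶠ ε in 𝓝[>] (0 : ℝ), ∀ T' ∈ M.elems, z ε ∉ closedCell T' :=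
      (Filter.eventually_all_finset _).2 fun T' hT' => h T' hT'
    obtain ⟨ε, h2, h3⟩ := (h1.and (hz.eventually (hΩ.mem_nhds hsΩ))).exists
    have h4 := subset_closure h3
    rw [M.cover, Set.mem_iUnion₂] at h4
    obtain ⟨T', hT', h5⟩ := h4
    exact h2 T' hT' h5
  have hyT' : y ∈ closedCell T' :=
    (isCompact_closedCell T').isClosed.mem_of_frequently_of_tendsto hfreq hz
  have hyc : y ∈ convexHull ℝ ((T : Set E3) ∩ (T' : Set E3)) :=
    M.matching T hT T' hT' ▸ ⟨hyT, hyT'⟩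
  -- By the matching condition `y` is in the hull of the common vertices. A vertex of `F` missing
  -- from `T'` would have zero coordinate at `y`, but these coordinates are positive.
  have hFT' : F ⊆ T' := by
    intro i hi
    by_contra hiT'
    have h1 := hTet.coord_eq_zero (a := ⟨i, hFT hi⟩) Set.inter_subset_left (fun h => hiT' h.2) hyc
    exact (hyi ⟨i, hFT hi⟩ fun h => Finset.ne_of_mem_erase hi (congrArg Subtype.val h)).ne' h1
  obtain ⟨ε, hε, hε0⟩ := (hfreq.and_eventually self_mem_nhdsWithin).exists
  -- The coordinate of `a` is negative at `z ε ∈ closedCell T'`, hence at some vertex of `T'`; as it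
  -- vanishes on `F`, that vertex is not in `F`.
  obtain ⟨b, hb, hba⟩ : ∃ b ∈ T', hTet.basis.coord a b < 0 := by
    by_contra! h
    have h1 := affine_nonneg_of_mem_convexHull (f := hTet.basis.coord a) h hε
    rw [hza] at h1
    have : (0 : ℝ) < ε := hε0
    linarith
  refine ⟨T', hT', hFT', b, hb, fun hbF => ?_, hba⟩
  have h1 := hTet.coord_of_ne (a := a) (b := ⟨b, hFT hbF⟩)
    fun h => Finset.ne_of_mem_erase hbF (congrArg Subtype.val h).symm
  exact hba.ne h1

end MatchingTetMesh

/-- A nonempty open set contains a point such that the line through it in a given direction misses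
the lines through finitely many pairs of points. -/
theorem exists_mem_line_avoiding {U : Set E3} (hU : IsOpen U) (hne : U.Nonempty) (d : E3)
    (V : Finset E3) : ∃ p ∈ U, ∀ u ∈ V, ∀ v ∈ V, ∀ s : ℝ,
      p + s • d ∉ convexHull ℝ ({u, v} : Set E3) := by
  classical
  -- A line in direction `d` can meet the segment from `u` to `v` only if its base point lies in
  -- this subspace. Its dimension is at most two, also when `u = v`, so it is a null set.
  let W : E3 → E3 → AffineSubspace ℝ E3 := fun u v =>
    AffineSubspace.mk' u (Submodule.span ℝ ({v - u, d} : Set E3))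
  have hW : ∀ u v, W u v ≠ ⊤ := by
    intro u v h
    have h1 : Submodule.span ℝ ({v - u, d} : Set E3) = ⊤ := by
      rw [← AffineSubspace.direction_mk' u (Submodule.span ℝ ({v - u, d} : Set E3))]
      exact (congrArg _ h).trans (AffineSubspace.direction_top ℝ E3 E3)
    have h2 := finrank_span_finset_le_card (R := ℝ) ({v - u, d} : Finset E3)
    have h3 : ({v - u, d} : Finset E3).card ≤ 2 := Finset.card_le_two
    rw [Finset.coe_pair] at h2
    rw [Set.finrank, h1, finrank_top] at h2
    simp at h2
    omega
  have hnull : volume (⋃ u ∈ V, ⋃ v ∈ V, (W u v : Set E3)) = 0 := by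
    exact (measure_biUnion_null_iff V.countable_toSet).2 fun u _ =>
      (measure_biUnion_null_iff V.countable_toSet).2 fun v _ =>
        Measure.addHaar_affineSubspace _ _ (hW u v)
  obtain ⟨p, hpU, hp⟩ : ∃ p ∈ U, p ∉ ⋃ u ∈ V, ⋃ v ∈ V, (W u v : Set E3) := by
    by_contra! h
    exact (hU.measure_pos volume hne).ne' (measure_mono_null h hnull)
  refine ⟨p, hpU, fun u hu v hv s hs => hp ?_⟩
  refine Set.mem_biUnion hu (Set.mem_biUnion hv ?_)
  rw [convexHull_pair, segment_eq_image_lineMap] at hs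
  obtain ⟨τ, -, hτ⟩ := hs
  change p ∈ AffineSubspace.mk' u _
  rw [AffineSubspace.mem_mk', Submodule.mem_span_pair]
  refine ⟨τ, -s, ?_⟩
  rw [AffineMap.lineMap_apply_module'] at hτ
  rw [vsub_eq_sub, eq_sub_of_add_eq hτ.symm]
  module

theorem eventually_coord_pos (f : E3 →ᵃ[ℝ] ℝ) {y d : E3} (hy : 0 < f y) :
    ∀ᶠ ε in 𝓝[>] (0 : ℝ), 0 < f (y + ε • d) := by
  have hc : Continuous fun ε : ℝ => f (y + ε • d) :=
    (AffineMap.continuous_of_finiteDimensional f).comp (by fun_prop)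
  have h := hc.tendsto 0
  simp only [zero_smul, add_zero] at h
  exact (h.mono_left nhdsWithin_le_nhds).eventually (lt_mem_nhds hy)

/-- On a line avoiding the edges, no two barycentric coordinates vanish simultaneously. -/
theorem IsTetrahedron.coord_pos_of_notMem_edges {T : Finset E3} (hT : IsTetrahedron T) {y : E3}
    (hy : y ∈ closedCell T)
    (hedge : ∀ u ∈ T, ∀ v ∈ T, y ∉ convexHull ℝ ({u, v} : Set E3))
    {a i : T} (ha : hT.basis.coord a y = 0) (hi : i ≠ a) : 0 < hT.basis.coord i y := by
  classical
  refine (hT.mem_closedCell.1 hy i).lt_of_ne fun h0 => ?_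
  have hcard : ((T.erase (a : E3)).erase i).card = 2 := by
    rw [Finset.card_erase_of_mem, Finset.card_erase_of_mem a.2, hT.1]
    exact Finset.mem_erase.2 ⟨fun h => hi (Subtype.ext h), i.2⟩
  obtain ⟨u, v, -, huv⟩ := Finset.card_eq_two.1 hcard
  have hmem : ∀ w ∈ ({u, v} : Finset E3), w ∈ T := fun w hw => by
    rw [← huv] at hw
    exact Finset.mem_of_mem_erase (Finset.mem_of_mem_erase hw)
  refine hedge u (hmem u (by simp)) v (hmem v (by simp))
    (hT.mem_convexHull hy fun c hc => ?_)
  have hc' : (c : E3) ∉ (T.erase (a : E3)).erase i := by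
    rw [huv]
    simpa using hc
  by_cases hca : c = a
  · rw [hca, ha]
  · by_cases hci : c = i
    · rw [hci, ← h0]
    · exact absurd (Finset.mem_erase.2 ⟨fun h => hci (Subtype.ext h),
        Finset.mem_erase.2 ⟨fun h => hca (Subtype.ext h), c.2⟩⟩) hc'

namespace MatchingTetMesh

variable {Ω : Set E3}

/-- A set of elements without boundary faces that is closed under passing to a face neighbour is
empty. -/
theorem not_of_neighbour_closed (M : MatchingTetMesh Ω) (hΩ : IsOpen Ω) {P : Finset E3 → Prop}
    (hbdry : ∀ T ∈ M.elems, P T → ∀ F ∈ T.powersetCard 3, ¬ closedCell F ⊆ frontier Ω)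
    (hstep : ∀ T ∈ M.elems, ∀ T' ∈ M.elems, ∀ F ∈ T.powersetCard 3, F ∈ T'.powersetCard 3 →
      P T → P T') : ∀ T ∈ M.elems, ¬ P T := by
  classical
  intro T₀ hT₀ hP₀
  obtain ⟨d, hd⟩ := exists_ne (0 : E3)
  obtain ⟨p, hp, hline⟩ := exists_mem_line_avoiding isOpen_interior
    (M.isTetrahedron T₀ hT₀).openCell_nonempty d (M.elems.biUnion id)
  have hedge : ∀ T ∈ M.elems, ∀ y : E3, (∃ s : ℝ, y = p + s • d) → ∀ u ∈ T, ∀ v ∈ T,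
      y ∉ convexHull ℝ ({u, v} : Set E3) := by
    rintro T hT y ⟨s, rfl⟩ u hu v hv
    exact hline u (Finset.mem_biUnion.2 ⟨T, hT, hu⟩) v (Finset.mem_biUnion.2 ⟨T, hT, hv⟩) s
  set K : Set E3 := ⋃ T ∈ M.elems.filter P, closedCell T with hK
  have hKc : IsCompact K :=
    (M.elems.filter P).isCompact_biUnion fun T _ => isCompact_closedCell T
  have hLc : IsClosed {y : E3 | ∃ s : ℝ, y = p + s • d} := by
    have : {y : E3 | ∃ s : ℝ, y = p + s • d} =
        (AffineSubspace.mk' p (Submodule.span ℝ {d}) : Set E3) := by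
      ext y
      simp only [Set.mem_ofPred_eq, SetLike.mem_coe, AffineSubspace.mem_mk',
        Submodule.mem_span_singleton, vsub_eq_sub, eq_sub_iff_add_eq']
      exact exists_congr fun s => eq_comm
    rw [this]
    exact AffineSubspace.closed_of_finiteDimensional _
  -- `y` is the last point of the line, in direction `d`, that belongs to an element satisfying `P`.
  obtain ⟨y, ⟨hyK, s, hys⟩, hmax⟩ := (hKc.inter_right hLc).exists_isMaxOn
    ⟨p, Set.mem_biUnion (Finset.mem_filter.2 ⟨hT₀, hP₀⟩) (interior_subset hp), 0, by simp⟩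
    (f := fun y => ⟪d, y⟫) (by fun_prop)
  have hout : ∀ T ∈ M.elems, P T → ∀ ε : ℝ, 0 < ε → y + ε • d ∉ closedCell T := by
    intro T hT hPT ε hε hmem
    have h1 := hmax ⟨Set.mem_biUnion (Finset.mem_filter.2 ⟨hT, hPT⟩) hmem, s + ε, by
      rw [hys]; module⟩
    simp only [Set.mem_ofPred_eq, inner_add_right, inner_smul_right] at h1
    have h2 : 0 < ε * ⟪d, d⟫ := mul_pos hε (real_inner_self_pos.2 hd)
    linarith
  obtain ⟨T₁, hT₁, hyT₁⟩ := Set.mem_iUnion₂.1 hyK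
  obtain ⟨hT₁, hP₁⟩ := Finset.mem_filter.1 hT₁
  have hTet₁ := M.isTetrahedron T₁ hT₁
  -- If all coordinates were positive, the line would continue inside `T₁` beyond `y`.
  obtain ⟨a, ha⟩ : ∃ a, hTet₁.basis.coord a y = 0 := by
    by_contra! h
    have h1 : ∀ᶠ ε in 𝓝[>] (0 : ℝ), ∀ i, 0 < hTet₁.basis.coord i (y + ε • d) :=
      eventually_all.2 fun i => eventually_coord_pos _
        ((hTet₁.mem_closedCell.1 hyT₁ i).lt_of_ne (h i).symm)
    obtain ⟨ε, h2, h3⟩ := (h1.and self_mem_nhdsWithin).exists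
    exact hout T₁ hT₁ hP₁ ε h3 (hTet₁.mem_closedCell.2 fun i => (h2 i).le)
  have hF₁ : T₁.erase (a : E3) ∈ T₁.powersetCard 3 :=
    Finset.mem_powersetCard.2 ⟨Finset.erase_subset _ _, by
      rw [Finset.card_erase_of_mem a.2, hTet₁.1]⟩
  obtain ⟨T₂, hT₂, hF₂, b, hb, hbF, hba⟩ :=
    M.exists_neighbour hΩ hT₁ a (hbdry T₁ hT₁ hP₁ _ hF₁)
  have hTet₂ := M.isTetrahedron T₂ hT₂
  have hF₂' : T₁.erase (a : E3) ∈ T₂.powersetCard 3 :=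
    Finset.mem_powersetCard.2 ⟨hF₂, (Finset.mem_powersetCard.1 hF₁).2⟩
  have hP₂ : P T₂ := hstep T₁ hT₁ T₂ hT₂ _ hF₁ hF₂' hP₁
  have herase := eq_erase_of_mem_powersetCard hTet₂.1 hF₂' hb hbF
  have hyF : y ∈ closedCell (T₁.erase (a : E3)) :=
    hTet₁.mem_convexHull hyT₁ fun c hc => by
      have : c = a := by
        by_contra hca
        exact hc (Finset.mem_coe.2 (Finset.mem_erase.2 ⟨fun h => hca (Subtype.ext h), c.2⟩))
      rw [this, ha]
  have hyT₂ : y ∈ closedCell T₂ := closedCell_mono hF₂ hyF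
  have hyb : hTet₂.basis.coord ⟨b, hb⟩ y = 0 :=
    hTet₂.coord_eq_zero (Finset.coe_subset.2 hF₂) hbF hyF
  -- Both coordinates are affine and vanish on the common face, so they are proportional. The factor
  -- `coord a b` is negative: `T₁` and `T₂` lie on opposite sides of the face.
  have hrel : ∀ x, hTet₁.basis.coord a x =
      hTet₂.basis.coord ⟨b, hb⟩ x * hTet₁.basis.coord a b := by
    intro x
    have h1 : hTet₁.basis.coord a =
        hTet₁.basis.coord a b • hTet₂.basis.coord ⟨b, hb⟩ := by
      refine AffineMap.ext_on hTet₂.basis.tot ?_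
      rintro _ ⟨i, rfl⟩
      by_cases hi : i = ⟨b, hb⟩
      · subst hi
        simp [hTet₂.coord_self ⟨b, hb⟩]
      · have h2 : (i : E3) ∈ T₁.erase (a : E3) := by
          rw [herase]
          exact Finset.mem_erase.2 ⟨fun h => hi (Subtype.ext h), i.2⟩
        have h3 := hTet₁.coord_of_ne (a := a) (b := ⟨i, Finset.mem_of_mem_erase h2⟩)
          fun h => Finset.ne_of_mem_erase h2 (congrArg Subtype.val h).symm
        have h4 := hTet₂.coord_of_ne (Ne.symm hi)
        change hTet₁.basis.coord a (i : E3) = hTet₁.basis.coord a b *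
          hTet₂.basis.coord ⟨b, hb⟩ (i : E3)
        rw [h4, mul_zero]
        exact h3
    conv_lhs => rw [h1]
    exact mul_comm _ _
  have e₁ : ∀ᶠ ε in 𝓝[>] (0 : ℝ), ∀ i : T₁, i ≠ a → 0 < hTet₁.basis.coord i (y + ε • d) :=
    eventually_all.2 fun i => eventually_all.2 fun hi => eventually_coord_pos _
      (hTet₁.coord_pos_of_notMem_edges hyT₁ (hedge T₁ hT₁ y ⟨s, hys⟩) ha hi)
  have e₂ : ∀ᶠ ε in 𝓝[>] (0 : ℝ), ∀ i : T₂, i ≠ ⟨b, hb⟩ →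
      0 < hTet₂.basis.coord i (y + ε • d) :=
    eventually_all.2 fun i => eventually_all.2 fun hi => eventually_coord_pos _
      (hTet₂.coord_pos_of_notMem_edges hyT₂ (hedge T₂ hT₂ y ⟨s, hys⟩) hyb hi)
  obtain ⟨ε, ⟨h₁, h₂⟩, hε⟩ := ((e₁.and e₂).and self_mem_nhdsWithin).exists
  -- Just beyond `y` all coordinates other than those of `a` and `b` remain positive, as the line
  -- misses the edges. The sign of the coordinate of `a` then decides whether the point is in `T₁`
  -- or `T₂`; both are excluded by `hout`.
  rcases le_or_gt 0 (hTet₁.basis.coord a (y + ε • d)) with h | h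
  · refine hout T₁ hT₁ hP₁ ε hε (hTet₁.mem_closedCell.2 fun i => ?_)
    by_cases hi : i = a
    · rwa [hi]
    · exact (h₁ i hi).le
  · refine hout T₂ hT₂ hP₂ ε hε (hTet₂.mem_closedCell.2 fun i => ?_)
    by_cases hi : i = ⟨b, hb⟩
    · rw [hrel] at h
      rw [hi]
      nlinarith
    · exact (h₂ i hi).le

end MatchingTetMesh

/-! ### Linearity of the reconstruction -/

/-- Uniqueness turns linearity of the local equations into linearity of the chosen solution. -/
theorem IsLocalGrad.eq_localGrad {k : ℕ} {T : Finset E3} (hT : IsTetrahedron T)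
    {qT : polyOn k (openCell T)} {qF : (F : FacesOf T) → polyOn (k + 1) (closedCell F.1)}
    {g : vecPolyOn (k + 1) (openCell T)} (h : IsLocalGrad k T qT qF g) :
    g = localGrad k hT qT qF :=
  (existsUnique_isLocalGrad k hT qT qF).unique h (localGrad_spec k hT qT qF)

theorem exists_continuous_of_mem_vecPolyOn {q : ℕ} {X : Set E3} (f : vecPolyOn q X) :
    ∃ P : E3 → E3, Continuous P ∧ ∀ x : X, f.1 x = P x := by
  obtain ⟨w, -, hw⟩ := f.2
  exact ⟨evalVec w, continuous_evalVec w, hw⟩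

theorem IsLocalGrad.add {k : ℕ} {T : Finset E3}
    {qT rT : polyOn k (openCell T)} {qF rF : (F : FacesOf T) → polyOn (k + 1) (closedCell F.1)}
    {g g' : vecPolyOn (k + 1) (openCell T)} (h : IsLocalGrad k T qT qF g)
    (h' : IsLocalGrad k T rT rF g') : IsLocalGrad k T (qT + rT) (qF + rF) (g + g') := by
  intro w hw
  obtain ⟨G, hG, hgG⟩ := exists_continuous_of_mem_vecPolyOn g
  obtain ⟨G', hG', hgG'⟩ := exists_continuous_of_mem_vecPolyOn g'
  obtain ⟨Q, hQ, hqQ⟩ := exists_continuous_of_mem_polyOn qT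
  obtain ⟨R, hR, hrR⟩ := exists_continuous_of_mem_polyOn rT
  have h1 : intCell T (fun x => ⟪(g + g').1 x, evalVec w x⟫) =
      intCell T (fun x => ⟪g.1 x, evalVec w x⟫) + intCell T (fun x => ⟪g'.1 x, evalVec w x⟫) := by
    simp only [intCell, Submodule.coe_add, Pi.add_apply, inner_add_left, hgG, hgG']
    exact integral_add (integrable_cell T (hG.inner (continuous_evalVec w)))
      (integrable_cell T (hG'.inner (continuous_evalVec w)))
  have h2 : intCell T (fun x => (qT + rT).1 x * evalPt (polyDiv w) x) =
      intCell T (fun x => qT.1 x * evalPt (polyDiv w) x) +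
        intCell T (fun x => rT.1 x * evalPt (polyDiv w) x) := by
    simp only [intCell, Submodule.coe_add, Pi.add_apply, add_mul, hqQ, hrR]
    exact integral_add (integrable_cell T (hQ.mul (continuous_evalPt _)))
      (integrable_cell T (hR.mul (continuous_evalPt _)))
  have h3 : ∀ F : FacesOf T,
      intFace F.1 (fun x => ((qF + rF) F).1 x * ⟪evalVec w x, outwardNormal T F.1⟫) =
        intFace F.1 (fun x => (qF F).1 x * ⟪evalVec w x, outwardNormal T F.1⟫) +
          intFace F.1 (fun x => (rF F).1 x * ⟪evalVec w x, outwardNormal T F.1⟫) := by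
    intro F
    obtain ⟨Q, hQ, hqQ⟩ := exists_continuous_of_mem_polyOn (qF F)
    obtain ⟨R, hR, hrR⟩ := exists_continuous_of_mem_polyOn (rF F)
    have hF : F.1.card = 3 := (Finset.mem_powersetCard.mp F.2).2
    simp only [intFace, Submodule.coe_add, Pi.add_apply, add_mul, hqQ, hrR]
    exact integral_add
      (integrable_face hF (hQ.mul ((continuous_evalVec _).inner continuous_const)))
      (integrable_face hF (hR.mul ((continuous_evalVec _).inner continuous_const)))
  rw [h1, h2, h w hw, h' w hw]
  simp only [h3, Finset.sum_add_distrib]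
  ring

theorem IsLocalGrad.smul {k : ℕ} {T : Finset E3} (c : ℝ)
    {qT : polyOn k (openCell T)} {qF : (F : FacesOf T) → polyOn (k + 1) (closedCell F.1)}
    {g : vecPolyOn (k + 1) (openCell T)} (h : IsLocalGrad k T qT qF g) :
    IsLocalGrad k T (c • qT) (c • qF) (c • g) := by
  intro w hw
  have h1 : intCell T (fun x => ⟪(c • g).1 x, evalVec w x⟫) =
      c * intCell T (fun x => ⟪g.1 x, evalVec w x⟫) := by
    simp only [intCell, Submodule.coe_smul, Pi.smul_apply, real_inner_smul_left]
    exact integral_const_mul _ _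
  have h2 : intCell T (fun x => (c • qT).1 x * evalPt (polyDiv w) x) =
      c * intCell T (fun x => qT.1 x * evalPt (polyDiv w) x) := by
    simp only [intCell, Submodule.coe_smul, Pi.smul_apply, smul_eq_mul, mul_assoc]
    exact integral_const_mul _ _
  have h3 : ∀ F : FacesOf T,
      intFace F.1 (fun x => ((c • qF) F).1 x * ⟪evalVec w x, outwardNormal T F.1⟫) =
        c * intFace F.1 (fun x => (qF F).1 x * ⟪evalVec w x, outwardNormal T F.1⟫) := by
    intro F
    simp only [intFace, Submodule.coe_smul, Pi.smul_apply, smul_eq_mul, mul_assoc]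
    exact integral_const_mul _ _
  rw [h1, h2, h w hw]
  simp only [h3, ← Finset.mul_sum]
  ring

/-! ### Linearity, square-integrability and kernel of the global reconstruction -/

namespace MatchingTetMesh

variable {Ω : Set E3} (M : MatchingTetMesh Ω) {k : ℕ}

theorem gradOn_add (q r : M.HybridSpace k) (T : M.Elem) :
    M.gradOn (q + r) T = M.gradOn q T + M.gradOn r T :=
  (((localGrad_spec k (M.isTetrahedron T.1 T.2) _ _).add
    (localGrad_spec k (M.isTetrahedron T.1 T.2) _ _)).eq_localGrad _).symm

theorem gradOn_smul (c : ℝ) (q : M.HybridSpace k) (T : M.Elem) :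
    M.gradOn (c • q) T = c • M.gradOn q T :=
  (((localGrad_spec k (M.isTetrahedron T.1 T.2) _ _).smul c).eq_localGrad _).symm

theorem grad_add (q r : M.HybridSpace k) : M.grad (q + r) = M.grad q + M.grad r := by
  classical
  funext x
  simp only [grad, Pi.add_apply, ← Finset.sum_add_distrib, gradOn_add]
  refine Finset.sum_congr rfl fun T _ => ?_
  split_ifs <;> simp

theorem grad_smul (c : ℝ) (q : M.HybridSpace k) : M.grad (c • q) = c • M.grad q := by
  classical
  funext x
  simp only [grad, Pi.smul_apply, Finset.smul_sum, gradOn_smul]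
  refine Finset.sum_congr rfl fun T _ => ?_
  split_ifs <;> simp

theorem grad_apply (q : M.HybridSpace k) (T : M.Elem) {x : E3} (hx : x ∈ openCell T.1) :
    M.grad q x = (M.gradOn q T).1 ⟨x, hx⟩ := by
  classical
  rw [grad, Finset.sum_eq_single T, dif_pos hx]
  · intro T' _ hne
    refine dif_neg fun hx' => ?_
    exact Set.disjoint_left.1 (M.disjoint T'.1 T'.2 T.1 T.2 fun h => hne (Subtype.ext h)) hx' hx
  · simp

/-- The reconstructed gradient is square-integrable. -/
theorem memLp_grad (q : M.HybridSpace k) : MemLp (M.grad q) 2 (volume.restrict Ω) := by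
  classical
  have h : M.grad q = ∑ T : M.Elem, fun x =>
      if hx : x ∈ openCell T.1 then (M.gradOn q T).1 ⟨x, hx⟩ else 0 := by
    funext x
    simp [grad]
  rw [h]
  refine memLp_finsetSum' _ fun T _ => MemLp.mono_measure Measure.restrict_le_self ?_
  obtain ⟨P, hP, hPT⟩ := exists_continuous_of_mem_vecPolyOn (M.gradOn q T)
  have h1 : (fun x => if hx : x ∈ openCell T.1 then (M.gradOn q T).1 ⟨x, hx⟩ else 0) =
      (openCell T.1).indicator P := by
    funext x
    by_cases hx : x ∈ openCell T.1
    · simp [hx, hPT]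
    · simp [hx]
  have hm : MeasurableSet (openCell T.1) := isOpen_interior.measurableSet
  rw [h1, memLp_indicator_iff_restrict hm]
  have hfin : IsFiniteMeasure ((volume : Measure E3).restrict (openCell T.1)) :=
    ⟨by
      rw [Measure.restrict_apply_univ]
      exact (measure_mono interior_subset).trans_lt (isCompact_closedCell T.1).measure_lt_top⟩
  obtain ⟨C, hC⟩ := (isCompact_closedCell T.1).exists_bound_of_continuousOn hP.continuousOn
  exact MemLp.of_bound hP.aestronglyMeasurable C
    ((ae_restrict_mem hm).mono fun x hx => hC x (interior_subset hx))

/-- The norm sees only `Ω`, while the mesh covers its closure. Each open cell lies in `closure Ω`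
and so meets `Ω` in a nonempty open set, and a polynomial field vanishing there is zero. -/
theorem gradOn_eq_zero_of_gradNorm (hΩ : IsOpen Ω) {q : M.HybridSpace k} (h : M.gradNorm q = 0)
    (T : M.Elem) : M.gradOn q T = 0 := by
  -- `toReal` also sends `⊤` to zero; square-integrability rules this out.
  have h1 : eLpNorm (M.grad q) 2 (volume.restrict Ω) = 0 :=
    (ENNReal.toReal_eq_zero_iff _).1 h |>.resolve_right (M.memLp_grad q).eLpNorm_ne_top
  rw [eLpNorm_eq_zero_iff (M.memLp_grad q).1 (by norm_num)] at h1
  obtain ⟨w, -, hw⟩ := (M.gradOn q T).2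
  have hU : IsOpen (Ω ∩ openCell T.1) := hΩ.inter isOpen_interior
  have hne : (Ω ∩ openCell T.1).Nonempty := by
    obtain ⟨x, hx⟩ := (M.isTetrahedron T.1 T.2).openCell_nonempty
    rw [Set.inter_comm]
    exact mem_closure_iff.1 (M.closedCell_subset T.2 (interior_subset hx)) _ isOpen_interior hx
  have h2 : evalVec w =ᵐ[volume.restrict (Ω ∩ openCell T.1)] (0 : E3 → E3) := by
    have h3 := ae_restrict_of_ae_restrict_of_subset
      (Set.inter_subset_left (s := Ω) (t := openCell T.1)) h1
    filter_upwards [h3, ae_restrict_mem hU.measurableSet] with x hx hxU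
    rw [← hx, M.grad_apply q T hxU.2, hw]
  have h4 := Measure.eqOn_open_of_ae_eq h2 hU (continuous_evalVec w).continuousOn
    continuousOn_const
  have h5 : w = 0 := evalVec_eq_zero_of_isOpen hU hne h4
  apply Subtype.ext
  funext x
  rw [hw, h5]
  ext i
  simp [evalVec, evalPt]

/-- A hybrid vector vanishing on the boundary faces is zero if its reconstructed gradient is. -/
theorem eq_zero_of_gradOn_eq_zero (hΩ : IsOpen Ω) {q : M.HybridSpace k}
    (hq : q ∈ M.hybridSpaceZero k) (h : ∀ T, M.gradOn q T = 0) : q = 0 := by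
  have hloc : ∀ T : M.Elem, IsLocalGrad k T.1 (q.1 T)
      (fun F => q.2 ⟨F.1, T.1, T.2, F.2⟩) 0 := fun T => by
    rw [← h T]
    exact localGrad_spec k (M.isTetrahedron T.1 T.2) _ _
  have hface : ∀ T : M.Elem, q.1 T = 0 → ∀ (F : M.Face), F.1 ∈ T.1.powersetCard 3 →
      q.2 F = 0 := fun T hT F hF => by
    have h1 := hloc T
    rw [hT] at h1
    exact h1.face_eq_zero (M.isTetrahedron T.1 T.2) ⟨F.1, hF⟩
  have hcell : ∀ (T : M.Elem) (F : M.Face), F.1 ∈ T.1.powersetCard 3 → q.2 F = 0 →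
      q.1 T = 0 := fun T F hF h0 =>
    (hloc T).cell_eq_zero (M.isTetrahedron T.1 T.2) ⟨F.1, hF⟩ h0
  -- A boundary face carries a zero unknown, which `hcell` passes to its element. If a neighbour has
  -- a zero element unknown, `hface` makes the unknown on the shared face zero, and `hcell` carries
  -- this back to the given element.
  have hall := M.not_of_neighbour_closed hΩ (P := fun T => ∃ hT : T ∈ M.elems, q.1 ⟨T, hT⟩ ≠ 0)
    (fun T hT ⟨_, hne⟩ F hF hb =>
      hne (hcell ⟨T, hT⟩ ⟨F, T, hT, hF⟩ hF (hq ⟨F, T, hT, hF⟩ hb)))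
    (fun T hT T' hT' F hF hF' ⟨_, hne⟩ => ⟨hT', fun h0 =>
      hne (hcell ⟨T, hT⟩ ⟨F, T, hT, hF⟩ hF (hface ⟨T', hT'⟩ h0 ⟨F, T, hT, hF⟩ hF'))⟩)
  have hzero : ∀ T : M.Elem, q.1 T = 0 := fun T => by
    by_contra hne
    exact hall T.1 T.2 ⟨T.2, hne⟩
  refine Prod.ext (funext hzero) (funext fun F => ?_)
  obtain ⟨T, hT, hF⟩ := F.2
  exact hface ⟨T, hT⟩ (hzero _) F hF

end MatchingTetMesh

/-! ### The norm axioms -/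

theorem lemma1 (Ω : Set E3) (hΩ : IsOpen Ω) (M : MatchingTetMesh Ω) (k : ℕ) :
    (∀ q : M.hybridSpaceZero k, 0 ≤ M.gradNorm q.1) ∧
    (∀ q : M.hybridSpaceZero k, M.gradNorm q.1 = 0 ↔ q = 0) ∧
    (∀ (c : ℝ) (q : M.hybridSpaceZero k), M.gradNorm (c • q).1 = |c| * M.gradNorm q.1) ∧
    (∀ q r : M.hybridSpaceZero k,
      M.gradNorm (q + r).1 ≤ M.gradNorm q.1 + M.gradNorm r.1) := by
  have hsmul : ∀ (c : ℝ) (q : M.hybridSpaceZero k),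
      M.gradNorm (c • q).1 = |c| * M.gradNorm q.1 := by
    intro c q
    rw [MatchingTetMesh.gradNorm, Submodule.coe_smul, M.grad_smul, eLpNorm_const_smul,
      ENNReal.toReal_mul, toReal_enorm, Real.norm_eq_abs, MatchingTetMesh.gradNorm]
  refine ⟨fun q => ENNReal.toReal_nonneg, fun q => ⟨fun h => ?_, ?_⟩, hsmul, fun q r => ?_⟩
  · exact Subtype.ext (M.eq_zero_of_gradOn_eq_zero hΩ q.2 (M.gradOn_eq_zero_of_gradNorm hΩ h))
  · rintro rfl
    simpa using hsmul 0 0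
  · simp only [MatchingTetMesh.gradNorm, Submodule.coe_add, M.grad_add]
    have hq := M.memLp_grad q.1
    have hr := M.memLp_grad r.1
    rw [← ENNReal.toReal_add hq.eLpNorm_ne_top hr.eLpNorm_ne_top]
    exact ENNReal.toReal_mono (ENNReal.add_ne_top.2 ⟨hq.eLpNorm_ne_top, hr.eLpNorm_ne_top⟩)
      (eLpNorm_add_le hq.1 hr.1 (by norm_num))
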